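/- Let $u_0,\hbar\in\mathbb C$ with $\hbar\neq 0$, and let $\hbar^{1/2}$ be the principal square root (the positive root if $\hbar>0$). On the Fock space $\mathbb C[q_1,q_2,\dots]$ let $\hat q_k$ be multiplication by $q_k$ and $\hat p_k=\hbar k\,\partial/\partial q_k$, $k\ge 1$. Put $s(t)=\frac{\sinh (t/2)}{t/2}$, $s(0)=1$, and $u(x)=u_0+\sum_{k\ge1}\left(\hat q_k e^{ikx}+\hat p_k e^{-ikx}\right)$, and define $$\hat{\mathcal H}(z,u_0,\hbar)=\frac{1}{2\pi\, s(\hbar^{1/2}z)}:\!\int_0^{2\pi} e^{z\, s(i\hbar^{1/2}z\partial_x)u(x)}\,dx\!:\;=\;1+\sum_{n\ge -1}\hat H_n z^{n+2},$$ where $:\ :$ is normal ordering (all $\hat p_k$ to the right of all $\hat q_k$) and the second equality, the Taylor expansion at $z=0$, defines the operators $\hat H_n=\hat H_n(u_0,\hbar)$. Let $h_k(q)$ be given by $\sum_{k\ge0}h_k(q)z^k=\exp\left(\sum_{k\ge1}q_k z^k/k\right)$ and $h_k=0$ for $k<0$. For a partition $\lambda=(\lambda_1\ge\lambda_2\ge\dots\ge\lambda_l>0)$,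 $l\geq 0$, extended by $\lambda_i=0$ for $i>l$, put $s_\lambda(q)=\det\left(h_{\lambda_i-i+j}(q)\right)_{1\le i,j\le l}$, and let $s_\lambda(q/\hbar^{1/2})$ be the polynomial obtained by replacing every $q_k$ by $q_k/\hbar^{1/2}$. Then: 1. For every partition $\lambda$ and every $z\in\mathbb C$ with $\operatorname{Re}(\hbar^{1/2}z)>0$ (for $\hbar>0$: $\operatorname{Re} z>0$), the series $$E(z,\lambda,u_0,\hbar)=\hbar^{1/2}z\,e^{zu_0}\sum_{i=1}^\infty e^{z\hbar^{1/2}\left(\lambda_i-i+\frac12\right)}$$ converges absolutely, and $s_\lambda(q/\hbar^{1/2})$ is an eigenvector of $\hat{\mathcal H}(z,u_0,\hbar)$ with eigenvalue $E(z,\lambda,u_0,\hbar)$. 2. For every partition $\lambda$, the polynomial $s_\lambda(q/\hbar^{1/2})$ is a common eigenvector of all $\hat H_n$, $n\ge-1$; its eigenvalues $E_n$ satisfy $E(z,\lambda,u_0,\hbar)=1+\sum_{n\ge-1}E_n z^{n+2}$ whenever $\operatorname{Re}(\hbar^{1/2}z)>0$ and $|\hbar^{1/2}z|<2\pi$. 3.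 For every $n\ge0$, the polynomials $s_\lambda(q)$ with $|\lambda|=n$ form a basis of the space of homogeneous polynomials of degree $n$, where $\deg q_k=k$. The polynomials $s_\lambda(q/\hbar^{1/2})$, $\lambda$ running over all partitions, form a basis of $\mathbb C[q_1,q_2,\dots]$, hence a complete common eigenbasis of the operators $\hat H_n$. -/

import Mathlib

open scoped BigOperators

noncomputable section

namespace HopfSchur

/-! ### Schur polynomials in the power-sum variables `q₁, q₂, …` -/

/-- The Fock space `ℂ[q₁, q₂, …]`. -/
abbrev Fock : Type := MvPolynomial ℕ+ ℂ

/-- The series `∑_{k ≥ 1} q_k z^k / k`, with `z` the power series variable. -/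
def qSeries : PowerSeries Fock :=
  PowerSeries.mk fun k =>
    if hk : 0 < k then MvPolynomial.C ((k : ℂ)⁻¹) * MvPolynomial.X (⟨k, hk⟩ : ℕ+) else 0

/-- The constant term of `∑_{k ≥ 1} q_k z^k / k` is zero, so it may be substituted into `exp`. -/
theorem hasSubst_qSeries : PowerSeries.HasSubst qSeries :=
  PowerSeries.HasSubst.of_constantCoeff_zero' (by
    rw [← PowerSeries.coeff_zero_eq_constantCoeff_apply, qSeries, PowerSeries.coeff_mk]
    simp)

/-- The polynomials `h_k(q)`, `k ∈ ℤ`: `∑_{k ≥ 0} h_k z^k = exp (∑_{k ≥ 1} q_k z^k / k)` and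
`h_k = 0` for `k < 0`. -/
def hPoly (k : ℤ) : Fock :=
  if k < 0 then 0
  else PowerSeries.coeff k.toNat ((PowerSeries.exp Fock).subst qSeries)

/-- The Schur polynomial `s_λ(q) = det (h_{λ_i - i + j}(q))_{1 ≤ i, j ≤ l(λ)}`. The partition `λ`
is given by its Young diagram: `λ_{i+1} = lam.rowLen i` and `l(λ) = lam.colLen 0`. -/
def schur (lam : YoungDiagram) : Fock :=
  Matrix.det (Matrix.of fun i j : Fin (lam.colLen 0) =>
    hPoly ((lam.rowLen i : ℤ) - (i : ℕ) + (j : ℕ)))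

/-- The square root `ħ^{1/2}` (principal branch; the positive root when `ħ > 0`). -/
def sqrtH (ħ : ℂ) : ℂ := ħ ^ (1 / 2 : ℂ)

/-- The rescaled Schur polynomial `s_λ(q / ħ^{1/2})`: every `q_k` is replaced by `q_k / ħ^{1/2}`. -/
def schurRescaled (ħ : ℂ) (lam : YoungDiagram) : Fock :=
  MvPolynomial.aeval
    (fun k : ℕ+ => MvPolynomial.C ((sqrtH ħ)⁻¹) * (MvPolynomial.X k : Fock)) (schur lam)

/-! ### Normal ordered operators on the Fock space -/

/-- The operator `p̂_k = ħ k ∂/∂q_k`. -/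
def pHat (ħ : ℂ) (k : ℕ+) : Module.End ℂ Fock :=
  (ħ * (k : ℕ)) • (MvPolynomial.pderiv k : Derivation ℂ Fock Fock).toLinearMap

theorem pHat_commute (ħ : ℂ) (j k : ℕ+) : Commute (pHat ħ j) (pHat ħ k) := by
  have h : ⁅(MvPolynomial.pderiv j : Derivation ℂ Fock Fock), (MvPolynomial.pderiv k : Derivation ℂ Fock Fock)⁆ = 0 := by
    apply MvPolynomial.derivation_ext
    intro i
    rw [Derivation.commutator_apply, MvPolynomial.pderiv_X, MvPolynomial.pderiv_X]
    by_cases h1 : k = i <;> by_cases h2 : j = i <;> simp [h1, h2]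
  have h' : Commute (MvPolynomial.pderiv j : Derivation ℂ Fock Fock).toLinearMap
      (MvPolynomial.pderiv k : Derivation ℂ Fock Fock).toLinearMap := by
    refine LinearMap.ext fun f => ?_
    have hf := DFunLike.congr_fun h f
    rw [Derivation.commutator_apply] at hf
    exact sub_eq_zero.mp hf
  exact (h'.smul_left _).smul_right _

/-- The commuting symbols: `Sum.inl k` is `q_k` and `Sum.inr k` is `p_k`. -/
abbrev Var : Type := ℕ+ ⊕ ℕ+

theorem pHat_pow_pairwise (ħ : ℂ) (ν : ℕ+ →₀ ℕ) :
    (ν.support : Set ℕ+).Pairwise (Function.onFun Commute fun k => pHat ħ k ^ ν k) :=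
  fun j _ k _ _ => (pHat_commute ħ j k).pow_pow (ν j) (ν k)

/-- The operator `∏_k p̂_k ^ ν_k` (the `p̂_k` commute with each other). -/
def pMonomial (ħ : ℂ) (ν : ℕ+ →₀ ℕ) : Module.End ℂ Fock :=
  ν.support.noncommProd (fun k => pHat ħ k ^ ν k) (pHat_pow_pairwise ħ ν)

/-- The operator `∏_k q̂_k ^ μ_k`, where `q̂_k` is multiplication by `q_k`. -/
def qMonomial (μ : ℕ+ →₀ ℕ) : Module.End ℂ Fock :=
  LinearMap.mulLeft ℂ (∏ k ∈ μ.support, (MvPolynomial.X k : Fock) ^ μ k)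

/-- The normally ordered operator `∏ q̂_k ^ μ_k ∏ p̂_k ^ ν_k` of the monomial
`∏ q_k ^ μ_k ∏ p_k ^ ν_k`: all `p̂`'s stand on the right. -/
def normalMonomial (ħ : ℂ) (d : Var →₀ ℕ) : Module.End ℂ Fock :=
  qMonomial (d.comapDomain Sum.inl Sum.inl_injective.injOn) *
    pMonomial ħ (d.comapDomain Sum.inr Sum.inr_injective.injOn)

/-- The normally ordered operator `:F:` of a symbol `F`, a series in the commuting variables
`q_k, p_k`: the linear operator `∑_d F_d :(q, p)^d:` on `ℂ[q₁, q₂, …]`, given on monomials (where,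
for the symbols used below, the sum has only finitely many nonzero terms). -/
def normalOrder (ħ : ℂ) (F : MvPowerSeries Var ℂ) : Module.End ℂ Fock :=
  (MvPolynomial.basisMonomials ℕ+ ℂ).constr ℂ fun m =>
    ∑ᶠ d : Var →₀ ℕ, MvPowerSeries.coeff d F • normalMonomial ħ d (MvPolynomial.monomial m 1)

/-! ### The generating operator of the quantized Hamiltonians -/

/-- The entire function `s(t) = sinh (t/2) / (t/2)`, `s(0) = 1`. -/
def sFun (t : ℂ) : ℂ := if t = 0 then 1 else Complex.sinh (t / 2) / (t / 2)

/-- The (possibly infinite) linear form `∑_v a_v v` in commuting variables. -/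
def linearForm {σ : Type} (a : σ → ℂ) : MvPowerSeries σ ℂ :=
  fun d => if d.degree = 1 then ∑ v ∈ d.support, a v else 0

/-- The exponential `∑_N F^N / N!` of a series with complex coefficients, the sum being taken
coefficient by coefficient. -/
def expSeries {σ : Type} (F : MvPowerSeries σ ℂ) : MvPowerSeries σ ℂ :=
  fun d => ∑' N : ℕ, MvPowerSeries.coeff d (F ^ N) / (N.factorial : ℂ)

/-- The Fourier mode in which a variable occurs in
`u(x) = u₀ + ∑_{k ≥ 1} (q_k e^{ikx} + p_k e^{-ikx})`. -/
def freq : Var → ℤ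
  | Sum.inl k => ((k : ℕ) : ℤ)
  | Sum.inr k => -((k : ℕ) : ℤ)

/-- The field `s(a ∂_x) u(x)`, where `u(x) = u₀ + ∑_{k ≥ 1} (q_k e^{ikx} + p_k e^{-ikx})`.
Since `∂_x e^{inx} = i n e^{inx}`, the operator `s(a ∂_x)` multiplies the mode `e^{inx}` by
`s(a i n)`; on the constant mode this is `s(0) = 1`. -/
def smoothedField (a u₀ : ℂ) (x : ℝ) : MvPowerSeries Var ℂ :=
  MvPowerSeries.C (sFun 0 * u₀) +
    linearForm fun v =>
      sFun (a * (Complex.I * (freq v : ℂ))) * Complex.exp (Complex.I * (freq v : ℂ) * (x : ℂ))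

/-- The symbol `(2π s(ħ^{1/2} z))⁻¹ ∫_0^{2π} exp (z s(i ħ^{1/2} z ∂_x) u(x)) dx`, a series in the
commuting variables `q_k, p_k`; the integral is taken coefficient by coefficient. -/
def symbol (z u₀ ħ : ℂ) : MvPowerSeries Var ℂ :=
  fun d => (2 * (Real.pi : ℂ) * sFun (sqrtH ħ * z))⁻¹ *
    ∫ x in (0 : ℝ)..(2 * Real.pi),
      MvPowerSeries.coeff d (expSeries (z • smoothedField (Complex.I * sqrtH ħ * z) u₀ x))

/-- The generating operator
`Ĥ(z, u₀, ħ) = (2π s(ħ^{1/2} z))⁻¹ :∫_0^{2π} exp (z s(i ħ^{1/2} z ∂_x) u(x)) dx:`. -/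
def genH (z u₀ ħ : ℂ) : Module.End ℂ Fock := normalOrder ħ (symbol z u₀ ħ)

/-- The coefficient of `z^m` in the Taylor expansion of the symbol at `z = 0`. -/
def symbolCoeff (m : ℕ) (u₀ ħ : ℂ) : MvPowerSeries Var ℂ :=
  fun d => iteratedDeriv m (fun z : ℂ => MvPowerSeries.coeff d (symbol z u₀ ħ)) 0 /
    (m.factorial : ℂ)

/-- The quantized Hamiltonians, the operator coefficients of `Ĥ(z) = 1 + ∑_{n ≥ -1} Ĥ_n z^{n+2}`.
They are numbered from zero: `quantumH k` is `Ĥ_{k-1}`, the coefficient of `z^{k+1}`. -/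
def quantumH (k : ℕ) (u₀ ħ : ℂ) : Module.End ℂ Fock := normalOrder ħ (symbolCoeff (k + 1) u₀ ħ)

/-! ### The eigenvalues -/

/-- The terms `e^{z ħ^{1/2} (λ_i - i + 1/2)}`, `i ≥ 1`, numbered from zero (`i = j + 1`). -/
def eigenTerm (z : ℂ) (lam : YoungDiagram) (ħ : ℂ) (j : ℕ) : ℂ :=
  Complex.exp (z * sqrtH ħ * ((lam.rowLen j : ℂ) - ((j : ℂ) + 1) + 1 / 2))

/-- `E(z, λ, u₀, ħ) = ħ^{1/2} z e^{z u₀} ∑_{i ≥ 1} e^{z ħ^{1/2} (λ_i - i + 1/2)}`. -/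
def eigenE (z : ℂ) (lam : YoungDiagram) (u₀ ħ : ℂ) : ℂ :=
  sqrtH ħ * z * Complex.exp (z * u₀) * ∑' j : ℕ, eigenTerm z lam ħ j

end HopfSchur

end

/-!
Put `w = ħ^{1/2} z`, `b = e^{w/2}`. After the rescaling `q_k = ħ^{1/2} Q_k` the modes of
`z s(i ħ^{1/2} z ∂_x) u(x)` become `(b^k - b^{-k}) Q_k / k` and `(b^k - b^{-k}) ∂/∂Q_k`, so the
normally ordered integral is, up to the factor `e^{z u₀} / s(w)`, the constant term `V_b` in `X`
of the vertex operator
`exp (∑ (b^k - b^{-k}) Q_k X^k / k) exp (∑ (b^k - b^{-k}) X^{-k} ∂/∂Q_k)`.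
The second factor is the shift `Q_k ↦ Q_k + (b^k - b^{-k}) X^{-k}`, hence `V_b = ∑_n F_n D_n` with
`∑ F_n X^n = H(bX) / H(X/b)`, `H(t) = ∑ h_k t^k`, and `D_n` the coefficients of the shift
(`genH_eq_shiftPairing`, `genH_scaleVars`). This holds for every `z`.

*Eigenvectors.* The Bernstein operators `B_m f = ∑_i h_{m+i} [Y^i] f(Q_k - Y^k)` build the
Jacobi–Trudi determinants row by row (`bernstein_jacobiTrudi`), and (`vertexOp_bernstein`)
`V_b B_m = b^{-2} B_m V_b + (1 - b^{-2}) b^{2m} B_m`.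
This relation is the delta function produced by two expansions of one simple pole; in coefficients
it is the identity `F(bt) H(t) = H(b² t)`. Induction on the number of rows gives the eigenvalue
`b^{-2l} + (1 - b^{-2}) ∑_{i<l} b^{2(λ_{i+1} - i)}`
of `V_b` on `s_λ` (`vertexOp_jacobiTrudi`). For `Re w > 0` the tail of the series `E` is geometric,
and `E` is this number times `e^{z u₀} / s(w)` (`eigenE_eq_eigenFun`).

*The Hamiltonians.* On a fixed monomial normal ordering is a finite sum, so it commutes with the
Taylor expansion at `z = 0` (`coeff_normalOrder_symbolCoeff`); the eigenvalue is holomorphic for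
`|w| < 2π`, as `s` vanishes only at the points of `2πi ℤ` other than `0`.

*Bases.* The span of all Jacobi–Trudi determinants with integer entries contains `1` and is stable
under the Bernstein operators, under the coefficients of the shift `Q_k ↦ Q_k + Y^k`, hence under
multiplication by each `h_m` and finally by each `Q_k`; so it is everything, and sorting the rows
turns such a determinant into `0` or `± s_λ` (`span_schur_eq_top`). Linear independence in each
degree follows by comparing the number of partitions with the number of monomials
(`linearIndependent_schur_card_eq`).
-/

noncomputable section

namespace HopfSchur

/-! ### Exponential generating series -/

/-- `IsExpSeries x G` says that `G = exp (∑_{k ≥ 1} x_k X^k / k)`, in the form of the differential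
equation `G' = (∑_{k ≥ 1} x_k X^{k-1}) G`, `G(0) = 1`; the value `x 0` is irrelevant. -/
structure IsExpSeries {R : Type*} [CommRing R] (x : ℕ → R) (G : PowerSeries R) : Prop where
  constantCoeff_eq : PowerSeries.constantCoeff G = 1
  derivative_eq : PowerSeries.derivative R G = PowerSeries.mk (fun n => x (n + 1)) * G

namespace IsExpSeries

variable {R S : Type*} [CommRing R] [CommRing S] {x y : ℕ → R} {G H : PowerSeries R}

theorem congr (hG : IsExpSeries x G) (h : ∀ n, x (n + 1) = y (n + 1)) : IsExpSeries y G :=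
  ⟨hG.constantCoeff_eq, by simpa only [h] using hG.derivative_eq⟩

theorem coeff_zero (hG : IsExpSeries x G) : PowerSeries.coeff 0 G = 1 := by
  simpa using hG.constantCoeff_eq

theorem coeff_succ (hG : IsExpSeries x G) (n : ℕ) :
    PowerSeries.coeff (n + 1) G * (n + 1) =
      ∑ p ∈ Finset.HasAntidiagonal.antidiagonal n, x (p.1 + 1) * PowerSeries.coeff p.2 G := by
  have h := congrArg (PowerSeries.coeff n) hG.derivative_eq
  rw [PowerSeries.coeff_derivative, PowerSeries.coeff_mul] at h
  simpa using h

theorem of_coeff (h0 : PowerSeries.coeff 0 G = 1)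
    (h : ∀ n, PowerSeries.coeff (n + 1) G * (n + 1) =
      ∑ p ∈ Finset.HasAntidiagonal.antidiagonal n, x (p.1 + 1) * PowerSeries.coeff p.2 G) :
    IsExpSeries x G := by
  refine ⟨by simpa using h0, PowerSeries.ext fun n => ?_⟩
  rw [PowerSeries.coeff_derivative, PowerSeries.coeff_mul, h n]
  simp

theorem unique [IsDomain R] [CharZero R] (hG : IsExpSeries x G) (hH : IsExpSeries y H)
    (hxy : ∀ n, x (n + 1) = y (n + 1)) : G = H := by
  ext n
  induction n using Nat.strong_induction_on with
  | _ n ih =>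
    cases n with
    | zero => rw [hG.coeff_zero, hH.coeff_zero]
    | succ n =>
      have hn : (n + 1 : R) ≠ 0 := by exact_mod_cast n.succ_ne_zero
      refine mul_right_cancel₀ hn ?_
      rw [hG.coeff_succ, hH.coeff_succ]
      refine Finset.sum_congr rfl fun p hp => ?_
      rw [hxy, ih p.2 (by have := Finset.HasAntidiagonal.mem_antidiagonal.1 hp; omega)]

theorem mul (hG : IsExpSeries x G) (hH : IsExpSeries y H) :
    IsExpSeries (fun k => x k + y k) (G * H) := by
  refine ⟨by simp [hG.constantCoeff_eq, hH.constantCoeff_eq], ?_⟩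
  have : PowerSeries.mk (fun n => x (n + 1) + y (n + 1)) =
      PowerSeries.mk (fun n => x (n + 1)) + PowerSeries.mk (fun n => y (n + 1)) := by
    ext; simp
  rw [Derivation.leibniz, hG.derivative_eq, hH.derivative_eq, this, smul_eq_mul, smul_eq_mul]
  ring

theorem map (hG : IsExpSeries x G) (f : R →+* S) :
    IsExpSeries (fun k => f (x k)) (PowerSeries.map f G) := by
  refine of_coeff (by simp [hG.constantCoeff_eq]) fun n => ?_
  have := congrArg f (hG.coeff_succ n)
  simpa using this

theorem rescale (hG : IsExpSeries x G) (b : R) :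
    IsExpSeries (fun k => b ^ k * x k) (PowerSeries.rescale b G) := by
  refine of_coeff (by simp [hG.constantCoeff_eq]) fun n => ?_
  rw [PowerSeries.coeff_rescale, mul_assoc, hG.coeff_succ, Finset.mul_sum]
  refine Finset.sum_congr rfl fun p hp => ?_
  rw [PowerSeries.coeff_rescale, ← Finset.HasAntidiagonal.mem_antidiagonal.1 hp]
  ring

theorem geometric (b : R) : IsExpSeries (fun k => b ^ k) (PowerSeries.mk fun n => b ^ n) := by
  refine of_coeff (by simp) fun n => ?_
  have : ∀ p ∈ Finset.HasAntidiagonal.antidiagonal n,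
      b ^ (p.1 + 1) * PowerSeries.coeff p.2 (PowerSeries.mk fun n => b ^ n) = b ^ (n + 1) := by
    intro p hp
    rw [PowerSeries.coeff_mk, ← Finset.HasAntidiagonal.mem_antidiagonal.1 hp]
    ring
  rw [Finset.sum_congr rfl this]
  simp [mul_comm]

theorem geometric_inv (b : R) :
    IsExpSeries (fun k => -b ^ k) (1 - PowerSeries.C b * PowerSeries.X) := by
  refine ⟨by simp, ?_⟩
  have h : PowerSeries.mk (fun n => -b ^ (n + 1)) =
      -(PowerSeries.C b * PowerSeries.mk fun n => b ^ n) := by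
    ext n; simp [pow_succ']
  have h2 : PowerSeries.mk (fun n => b ^ n) * (1 - PowerSeries.C b * PowerSeries.X) = 1 := by
    ext n
    rw [mul_sub, mul_one, mul_left_comm, map_sub, PowerSeries.coeff_C_mul]
    cases n with
    | zero => simp
    | succ n => simp [PowerSeries.coeff_succ_mul_X, pow_succ', PowerSeries.coeff_one]
  rw [h, neg_mul, mul_assoc, h2]
  simp [PowerSeries.derivative_C]

end IsExpSeries

/-- The weight `∑ k μ_k` of an exponent `μ`, i.e. the degree of `q^μ` when `deg q_k = k`. -/
def wt : (ℕ+ →₀ ℕ) →+ ℕ := Finsupp.weight fun k : ℕ+ => (k : ℕ)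

theorem wt_single (k : ℕ+) (j : ℕ) : wt (Finsupp.single k j) = j * k := by
  simp [wt, Finsupp.weight_single]

theorem wt_eq_sum (μ : ℕ+ →₀ ℕ) : wt μ = ∑ k ∈ μ.support, μ k * (k : ℕ) := by
  simp [wt, Finsupp.weight_apply, Finsupp.sum]

theorem wt_mono {μ ν : ℕ+ →₀ ℕ} (h : μ ≤ ν) : wt μ ≤ wt ν := by
  obtain ⟨d, rfl⟩ := exists_add_of_le h
  simp

theorem mul_le_wt (μ : ℕ+ →₀ ℕ) (k : ℕ+) : μ k * (k : ℕ) ≤ wt μ := by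
  have : Finsupp.single k (μ k) ≤ μ := by simp
  simpa [wt_single] using wt_mono this

theorem finite_wt_eq (n : ℕ) : {μ : ℕ+ →₀ ℕ | wt μ = n}.Finite := by
  classical
  refine Set.Finite.subset (Finset.finite_toSet
    ((Finset.Icc (1 : ℕ+) n.succPNat).finsupp fun _ => Finset.range (n + 1))) ?_
  intro μ hμ
  have hμ' : wt μ = n := hμ
  rw [Finset.mem_coe, Finset.mem_finsupp_iff]
  refine ⟨fun k hk => ?_, fun k _ => ?_⟩
  · have h1 := mul_le_wt μ k
    have h2 : 1 ≤ μ k := Nat.one_le_iff_ne_zero.2 (Finsupp.mem_support_iff.1 hk)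
    have h3 := Nat.mul_le_mul_right (k : ℕ) h2
    refine Finset.mem_Icc.2 ⟨PNat.coe_le_coe _ _ |>.1 k.pos, ?_⟩
    rw [← PNat.coe_le_coe, Nat.succPNat_coe]
    omega
  · have h1 := mul_le_wt μ k
    have h2 := Nat.mul_le_mul_left (μ k) k.pos
    exact Finset.mem_range.2 (by omega)

/-- The exponents of weight `n`. -/
def exponents (n : ℕ) : Finset (ℕ+ →₀ ℕ) := (finite_wt_eq n).toFinset

@[simp] theorem mem_exponents {n : ℕ} {μ : ℕ+ →₀ ℕ} : μ ∈ exponents n ↔ wt μ = n := by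
  simp [exponents]

/-- The product `∏_k y_k ^ μ_k / μ_k!`. -/
def dividedMonomial (y : ℕ+ → Fock) (μ : ℕ+ →₀ ℕ) : Fock :=
  μ.prod fun k j => MvPolynomial.C (((j.factorial : ℂ))⁻¹) * y k ^ j

theorem dividedMonomial_single_add (y : ℕ+ → Fock) (μ : ℕ+ →₀ ℕ) (k : ℕ+) :
    (((μ k + 1 : ℕ) : ℂ)) • dividedMonomial y (Finsupp.single k 1 + μ) =
      y k * dividedMonomial y μ := by
  classical
  have h0 : ∀ k : ℕ+, (fun (k : ℕ+) (j : ℕ) =>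
      (MvPolynomial.C (((j.factorial : ℂ))⁻¹) : Fock) * y k ^ j) k 0 = 1 := by
    intro k; simp
  have hs : ∀ ν : ℕ+ →₀ ℕ, ν.support ⊆ insert k μ.support → dividedMonomial y ν =
      (MvPolynomial.C ((((ν k).factorial : ℂ))⁻¹) * y k ^ ν k) *
        ∏ i ∈ (insert k μ.support).erase k,
          (MvPolynomial.C ((((ν i).factorial : ℂ))⁻¹) * y i ^ ν i) := by
    intro ν hν
    rw [dividedMonomial, Finsupp.prod_of_support_subset _ hν _ (fun i _ => h0 i),
      Finset.mul_prod_erase _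
        (fun i => (MvPolynomial.C ((((ν i).factorial : ℂ))⁻¹) : Fock) * y i ^ ν i)
        (Finset.mem_insert_self _ _)]
  rw [hs μ (Finset.subset_insert _ _), hs (Finsupp.single k 1 + μ)]
  · have : ∀ i ∈ (insert k μ.support).erase k, (Finsupp.single k 1 + μ : ℕ+ →₀ ℕ) i = μ i := by
      intro i hi
      simp [(Finset.ne_of_mem_erase hi).symm]
    rw [Finset.prod_congr rfl fun i hi => by rw [this i hi], ← smul_mul_assoc, ← mul_assoc]
    congr 1
    rw [Finsupp.add_apply, Finsupp.single_eq_same, add_comm 1, Nat.factorial_succ,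
      MvPolynomial.smul_eq_C_mul, ← mul_assoc, ← map_mul, pow_succ]
    have h1 : ((μ k + 1 : ℕ) : ℂ) ≠ 0 := by exact_mod_cast (μ k).succ_ne_zero
    rw [Nat.cast_mul, mul_inv, mul_inv_cancel_left₀ h1]
    ring
  · refine Finsupp.support_add.trans (Finset.union_subset ?_ (Finset.subset_insert _ _))
    exact (Finsupp.support_single_subset).trans (by simp)

/-- The coefficient of `X^n` in `exp (∑_k y_k X^k)`. -/
def expCoeff (y : ℕ+ → Fock) (n : ℕ) : Fock := ∑ μ ∈ exponents n, dividedMonomial y μ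

theorem isExpSeries_expCoeff (y : ℕ+ → Fock) :
    IsExpSeries (fun k => (k : Fock) * y (Nat.toPNat' k)) (PowerSeries.mk (expCoeff y)) := by
  classical
  refine IsExpSeries.of_coeff ?_ fun n => ?_
  · have : exponents 0 = {0} := by
      ext μ
      rw [mem_exponents, Finset.mem_singleton]
      refine ⟨fun h => ?_, fun h => by simp [h]⟩
      ext k
      have := mul_le_wt μ k
      rw [h] at this
      simpa [k.ne_zero] using this
    simp [expCoeff, this, dividedMonomial]
  · simp only [PowerSeries.coeff_mk, expCoeff, Finset.mul_sum, Finset.sum_mul]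
    -- Double counting of the pairs `(μ, k)` with `k` in the support of `μ`.
    have h1 : ∀ μ ∈ exponents (n + 1), dividedMonomial y μ * ((n : Fock) + 1) =
        ∑ k ∈ μ.support, ((k : ℕ) : Fock) * (((μ k : ℕ) : ℂ) • dividedMonomial y μ) := by
      intro μ hμ
      rw [mem_exponents] at hμ
      have : ((n : Fock) + 1) = ((wt μ : ℕ) : Fock) := by rw [hμ]; push_cast; rfl
      rw [this, wt_eq_sum, Nat.cast_sum, Finset.mul_sum]
      refine Finset.sum_congr rfl fun k _ => ?_
      rw [MvPolynomial.smul_eq_C_mul, map_natCast]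
      push_cast; ring
    rw [Finset.sum_congr rfl h1, Finset.sum_sigma', Finset.sum_sigma']
    refine Finset.sum_bij' (fun a _ => ⟨((a.2 : ℕ) - 1, n + 1 - a.2), a.1 - Finsupp.single a.2 1⟩)
      (fun a _ => ⟨Finsupp.single (Nat.succPNat a.1.1) 1 + a.2, Nat.succPNat a.1.1⟩) ?_ ?_ ?_ ?_ ?_
    · rintro ⟨μ, k⟩ h
      simp only [Finset.mem_sigma, mem_exponents, Finsupp.mem_support_iff,
        Finset.HasAntidiagonal.mem_antidiagonal] at h ⊢
      have hk : Finsupp.single k 1 ≤ μ := by simpa [Nat.one_le_iff_ne_zero] using h.2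
      have hw := congrArg wt (tsub_add_cancel_of_le hk)
      rw [map_add, wt_single, h.1] at hw
      have := k.pos
      omega
    · rintro ⟨⟨i, j⟩, μ⟩ h
      simp only [Finset.mem_sigma, mem_exponents, Finsupp.mem_support_iff,
        Finset.HasAntidiagonal.mem_antidiagonal] at h ⊢
      rw [map_add, wt_single, h.2, Nat.succPNat_coe]
      refine ⟨by omega, by simp⟩
    · rintro ⟨μ, k⟩ h
      simp only [Finset.mem_sigma, mem_exponents, Finsupp.mem_support_iff] at h
      have hk : Finsupp.single k 1 ≤ μ := by simpa [Nat.one_le_iff_ne_zero] using h.2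
      have : Nat.succPNat ((k : ℕ) - 1) = k :=
        PNat.eq (by simp [Nat.succPNat_coe]; have := k.pos; omega)
      simp only [this]
      rw [add_tsub_cancel_of_le hk]
    · rintro ⟨⟨i, j⟩, μ⟩ h
      simp only [Finset.mem_sigma, mem_exponents, Finset.HasAntidiagonal.mem_antidiagonal] at h
      have : n + 1 - (i + 1) = j := by omega
      simp [Nat.succPNat_coe, this]
    · rintro ⟨μ, k⟩ h
      simp only [Finset.mem_sigma, mem_exponents, Finsupp.mem_support_iff] at h
      have hk : Finsupp.single k 1 ≤ μ := by simpa [Nat.one_le_iff_ne_zero] using h.2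
      have h2 := dividedMonomial_single_add y (μ - Finsupp.single k 1) k
      rw [add_tsub_cancel_of_le hk] at h2
      have h3 : (μ - Finsupp.single k 1 : ℕ+ →₀ ℕ) k + 1 = μ k := by
        have := h.2
        simp; omega
      rw [h3] at h2
      have hkk : (k : ℕ) - 1 + 1 = k := by have := k.pos; omega
      simp only [hkk]
      rw [h2, mul_assoc, PNat.coe_toPNat']

/-! ### The complete homogeneous polynomials -/

/-- The generating series `∑_k h_k t^k`. -/
def hSeries : PowerSeries Fock := (PowerSeries.exp Fock).subst qSeries

theorem hPoly_natCast (n : ℕ) : hPoly n = PowerSeries.coeff n hSeries := by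
  simp [hPoly, hSeries]

theorem hPoly_of_neg {k : ℤ} (hk : k < 0) : hPoly k = 0 := by simp [hPoly, hk]

theorem isExpSeries_hSeries :
    IsExpSeries (fun k => (MvPolynomial.X (Nat.toPNat' k) : Fock)) hSeries := by
  refine ⟨?_, ?_⟩
  · rw [hSeries, ← PowerSeries.coeff_zero_eq_constantCoeff_apply,
      PowerSeries.coeff_subst' hasSubst_qSeries, finsum_eq_single _ 0]
    · simp
    · intro n hn
      have : PowerSeries.constantCoeff qSeries = 0 := by
        rw [← PowerSeries.coeff_zero_eq_constantCoeff_apply, qSeries, PowerSeries.coeff_mk]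
        simp
      simp [this, hn]
  · rw [hSeries, PowerSeries.derivative_subst hasSubst_qSeries, PowerSeries.derivative_exp,
      mul_comm]
    congr 1
    ext1 n
    have h1 : ((n : ℂ) + 1) ≠ 0 := by exact_mod_cast n.succ_ne_zero
    have h2 : ((n : Fock) + 1) = MvPolynomial.C ((n : ℂ) + 1) := by simp
    rw [PowerSeries.coeff_derivative, qSeries, PowerSeries.coeff_mk, PowerSeries.coeff_mk,
      dif_pos n.succ_pos, h2]
    have hx : ∀ p : Fock, MvPolynomial.C (((n + 1 : ℕ) : ℂ)⁻¹) * p * MvPolynomial.C ((n : ℂ) + 1) =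
        p := by
      intro p
      rw [mul_right_comm, ← map_mul, Nat.cast_add_one, inv_mul_cancel₀ h1, map_one, one_mul]
    exact hx _

theorem hPoly_zero : hPoly 0 = 1 := by
  have := hPoly_natCast 0
  simpa using this.trans isExpSeries_hSeries.coeff_zero

/-! ### Shifts of the variables -/

/-- The shift `q_k ↦ q_k + τ_k Y^k`, with values in the polynomials in `Y`. -/
def shift (τ : ℕ+ → ℂ) : Fock →ₐ[ℂ] Polynomial Fock :=
  MvPolynomial.aeval fun k =>
    Polynomial.C (MvPolynomial.X k) + Polynomial.monomial (k : ℕ) (MvPolynomial.C (τ k))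

theorem shift_X (τ : ℕ+ → ℂ) (k : ℕ+) : shift τ (MvPolynomial.X k) =
    Polynomial.C (MvPolynomial.X k) + Polynomial.monomial (k : ℕ) (MvPolynomial.C (τ k)) := by
  simp [shift]

theorem shift_C (τ : ℕ+ → ℂ) (a : ℂ) :
    shift τ (MvPolynomial.C a) = Polynomial.C (MvPolynomial.C a) := by
  rw [← MvPolynomial.algebraMap_eq, AlgHom.commutes]
  rfl

/-- The coefficient of `Y^n` in the shift `q_k ↦ q_k + τ_k Y^k`. -/
def shiftCoeff (τ : ℕ+ → ℂ) (n : ℕ) : Fock →ₗ[ℂ] Fock :=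
  (Polynomial.lcoeff Fock n).restrictScalars ℂ ∘ₗ (shift τ).toLinearMap

theorem shiftCoeff_apply (τ : ℕ+ → ℂ) (n : ℕ) (f : Fock) :
    shiftCoeff τ n f = (shift τ f).coeff n := rfl

theorem shiftCoeff_C (τ : ℕ+ → ℂ) (n : ℕ) (a : ℂ) :
    shiftCoeff τ n (MvPolynomial.C a) = if n = 0 then MvPolynomial.C a else 0 := by
  rw [shiftCoeff_apply, shift_C, Polynomial.coeff_C]

theorem shiftCoeff_mul (τ : ℕ+ → ℂ) (n : ℕ) (f g : Fock) : shiftCoeff τ n (f * g) =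
    ∑ p ∈ Finset.HasAntidiagonal.antidiagonal n, shiftCoeff τ p.1 f * shiftCoeff τ p.2 g := by
  simp only [shiftCoeff_apply, map_mul, Polynomial.coeff_mul]

theorem shiftCoeff_mul_X (τ : ℕ+ → ℂ) (n : ℕ) (f : Fock) (k : ℕ+) :
    shiftCoeff τ n (f * MvPolynomial.X k) = shiftCoeff τ n f * MvPolynomial.X k +
      if (k : ℕ) ≤ n then τ k • shiftCoeff τ (n - k) f else 0 := by
  rw [shiftCoeff_apply, map_mul, shift_X, mul_add, Polynomial.coeff_add, Polynomial.coeff_mul_C,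
    ← mul_one (MvPolynomial.C (τ k)), ← Polynomial.C_mul_X_pow_eq_monomial, map_mul, mul_assoc,
    mul_left_comm, Polynomial.coeff_C_mul, Polynomial.C_1, one_mul, Polynomial.coeff_mul_X_pow',
    shiftCoeff_apply, shiftCoeff_apply, MvPolynomial.smul_eq_C_mul, mul_ite, mul_zero]

theorem shiftCoeff_zero (τ : ℕ+ → ℂ) (f : Fock) : shiftCoeff τ 0 f = f := by
  induction f using MvPolynomial.induction_on with
  | C a => simp [shiftCoeff_C]
  | add f g hf hg => simp [hf, hg]
  | mul_X f k hf => simp [shiftCoeff_mul_X, hf, k.ne_zero]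

theorem shiftCoeff_comm (τ τ' : ℕ+ → ℂ) (n i : ℕ) (f : Fock) :
    shiftCoeff τ n (shiftCoeff τ' i f) = shiftCoeff τ' i (shiftCoeff τ n f) := by
  induction f using MvPolynomial.induction_on generalizing n i with
  | C a => simp only [shiftCoeff_C]; split_ifs <;> simp [shiftCoeff_C, *]
  | add f g hf hg => simp [hf, hg]
  | mul_X f k hf =>
    rw [shiftCoeff_mul_X, shiftCoeff_mul_X, map_add, map_add, shiftCoeff_mul_X,
      shiftCoeff_mul_X, hf]
    split_ifs <;> simp [hf]
    abel_nf

theorem exists_shiftCoeff_eq_zero (τ : ℕ+ → ℂ) (f : Fock) :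
    ∃ N, ∀ n, N ≤ n → shiftCoeff τ n f = 0 :=
  ⟨(shift τ f).natDegree + 1, fun _ hn =>
    Polynomial.coeff_eq_zero_of_natDegree_lt (Nat.lt_of_succ_le hn)⟩

theorem exists_shiftCoeff_shiftCoeff_eq_zero (τ τ' : ℕ+ → ℂ) (f : Fock) :
    ∃ N, ∀ n i, N ≤ n ∨ N ≤ i → shiftCoeff τ n (shiftCoeff τ' i f) = 0 := by
  obtain ⟨N₁, h₁⟩ := exists_shiftCoeff_eq_zero τ' f
  obtain ⟨N₂, h₂⟩ := exists_shiftCoeff_eq_zero τ f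
  choose N h using fun i => exists_shiftCoeff_eq_zero τ (shiftCoeff τ' i f)
  refine ⟨max N₁ ((Finset.range N₁).sup N), fun n i hni => ?_⟩
  by_cases hi : N₁ ≤ i
  · rw [h₁ i hi, map_zero]
  · rcases hni with hn | hn
    · exact h i n ((Finset.le_sup (f := N) (Finset.mem_range.2 (not_le.1 hi))).trans
        ((le_max_right _ _).trans hn))
    · exact absurd ((le_max_left _ _).trans hn) hi

/-- Composition of two shifts, along `Y ↦ b Y` in the inner one. -/
theorem sum_shiftCoeff_shiftCoeff (τ τ' : ℕ+ → ℂ) (b : ℂ) (N : ℕ) (f : Fock) :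
    ∑ p ∈ Finset.HasAntidiagonal.antidiagonal N,
      b ^ p.2 • shiftCoeff τ p.1 (shiftCoeff τ' p.2 f) =
    shiftCoeff (fun k => τ k + b ^ (k : ℕ) * τ' k) N f := by
  have key : (Polynomial.eval₂RingHom (shift τ : Fock →+* Polynomial Fock)
      (Polynomial.C (MvPolynomial.C b) * Polynomial.X)).comp (shift τ' : Fock →+* Polynomial Fock) =
      (shift (fun k => τ k + b ^ (k : ℕ) * τ' k) : Fock →+* Polynomial Fock) := by
    refine MvPolynomial.ringHom_ext (fun a => ?_) fun k => ?_
    · simp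
    · simp only [RingHom.comp_apply, RingHom.coe_coe, shift_X, map_add,
        Polynomial.coe_eval₂RingHom, Polynomial.eval₂_C, Polynomial.eval₂_monomial, shift_C,
        map_mul]
      rw [mul_pow, ← Polynomial.C_pow, ← mul_assoc, ← Polynomial.C_mul,
        Polynomial.C_mul_X_pow_eq_monomial, add_assoc, mul_comm, map_pow]
  have h := congrArg (fun g : Polynomial Fock => g.coeff N) (DFunLike.congr_fun key f)
  simp only [RingHom.comp_apply, RingHom.coe_coe, Polynomial.coe_eval₂RingHom,
    Polynomial.eval₂_eq_sum, Polynomial.sum_def, Polynomial.finsetSum_coeff] at h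
  rw [shiftCoeff_apply, ← h, Finset.Nat.sum_antidiagonal_eq_sum_range_succ_mk,
    ← Finset.sum_range_reflect]
  have hterm : ∀ i, (shift τ ((shift τ' f).coeff i) *
      (Polynomial.C (MvPolynomial.C b) * Polynomial.X) ^ i).coeff N =
      if i ≤ N then b ^ i • shiftCoeff τ (N - i) (shiftCoeff τ' i f) else 0 := by
    intro i
    rw [mul_pow, ← Polynomial.C_pow, mul_left_comm, Polynomial.coeff_C_mul,
      Polynomial.coeff_mul_X_pow', mul_ite, mul_zero, ← map_pow, ← MvPolynomial.smul_eq_C_mul]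
    rfl
  simp only [hterm]
  rw [← Finset.sum_filter]
  refine (Finset.sum_subset_zero_on_sdiff ?_ ?_ ?_).symm
  · intro i hi
    rw [Finset.mem_filter] at hi
    exact Finset.mem_range.2 (by omega)
  · intro i hi
    simp only [Finset.mem_sdiff, Finset.mem_range, Finset.mem_filter, Polynomial.mem_support_iff,
      not_and, not_le] at hi
    have : shiftCoeff τ' i f = 0 := by
      by_contra h0
      have := hi.2 h0
      omega
    have hi' : N - (N + 1 - 1 - i) = i := by omega
    simp only [hi']
    simp [this]
  · intro i hi
    rw [Finset.mem_filter] at hi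
    have hi' : N - (N - i) = i := by omega
    have hi'' : N + 1 - 1 - i = N - i := by omega
    simp only [hi'', hi']

theorem shiftCoeff_zero_left (n : ℕ) (f : Fock) :
    shiftCoeff (fun _ => 0) n f = if n = 0 then f else 0 := by
  induction f using MvPolynomial.induction_on with
  | C a => rw [shiftCoeff_C]
  | add f g hf hg => rw [map_add, hf, hg]; split_ifs <;> simp
  | mul_X f k hf => rw [shiftCoeff_mul_X, hf]; split_ifs <;> simp

theorem shiftCoeff_scale (τ : ℕ+ → ℂ) (b : ℂ) (n : ℕ) (f : Fock) :
    shiftCoeff (fun k => b ^ (k : ℕ) * τ k) n f = b ^ n • shiftCoeff τ n f := by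
  have h := sum_shiftCoeff_shiftCoeff (fun _ => 0) τ b n f
  simp only [zero_add] at h
  rw [← h, Finset.sum_eq_single (0, n)]
  · simp [shiftCoeff_zero]
  · rintro ⟨i, j⟩ hp hne
    rw [shiftCoeff_zero_left, if_neg, smul_zero]
    rintro rfl
    exact hne (by simpa using hp)
  · simp

/-- The functional `∑ a_n Y^n ↦ ∑ a_n F_n` on the polynomials in `Y`. -/
def pairing (F : ℕ → Fock) : Polynomial Fock →ₗ[Fock] Fock :=
  Polynomial.lsum fun n => LinearMap.mulRight Fock (F n)

theorem pairing_monomial (F : ℕ → Fock) (n : ℕ) (a : Fock) :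
    pairing F (Polynomial.monomial n a) = a * F n := by
  simp [pairing, Polynomial.lsum]

theorem pairing_mul_monomial (F : ℕ → Fock) (r : ℕ) (a : Fock) (p : Polynomial Fock) :
    pairing F (p * Polynomial.monomial r a) = pairing (fun n => F (n + r)) p * a := by
  induction p using Polynomial.induction_on' with
  | add p q hp hq => simp [add_mul, hp, hq]
  | monomial n c =>
    rw [Polynomial.monomial_mul_monomial, pairing_monomial, pairing_monomial]
    ring

/-- The operator `f ↦ ∑_n F_n [Y^n] f(q_k + τ_k Y^k)`. -/
def shiftPairing (F : ℕ → Fock) (τ : ℕ+ → ℂ) : Fock →ₗ[ℂ] Fock :=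
  (pairing F).restrictScalars ℂ ∘ₗ (shift τ).toLinearMap

theorem shiftPairing_apply (F : ℕ → Fock) (τ : ℕ+ → ℂ) (f : Fock) :
    shiftPairing F τ f = pairing F (shift τ f) := rfl

theorem shiftPairing_eq_sum (F : ℕ → Fock) (τ : ℕ+ → ℂ) (f : Fock) {N : ℕ}
    (hN : ∀ n, N ≤ n → shiftCoeff τ n f = 0) :
    shiftPairing F τ f = ∑ n ∈ Finset.range N, shiftCoeff τ n f * F n := by
  rw [shiftPairing_apply, pairing, Polynomial.lsum_apply, Polynomial.sum_def]
  refine Finset.sum_subset_zero_on_sdiff ?_ ?_ ?_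
  · intro n hn
    by_contra h
    exact Polynomial.mem_support_iff.1 hn (hN n (by simpa using h))
  · intro n hn
    rw [Finset.mem_sdiff, Polynomial.notMem_support_iff] at hn
    rw [shiftCoeff_apply, hn.2, zero_mul]
  · intro n _
    simp [shiftCoeff_apply]

/-! ### Shifts of the generating series -/

/-- The coefficients of `(1 - v t) / (1 - u t)`. -/
def ratioCoeff (u v : ℂ) : ℕ → ℂ
  | 0 => 1
  | r + 1 => u ^ r * (u - v)

theorem isExpSeries_ratio (u v : ℂ) :
    IsExpSeries (fun k => Polynomial.monomial k (MvPolynomial.C (u ^ k - v ^ k) : Fock))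
      (PowerSeries.mk fun r => Polynomial.monomial r (MvPolynomial.C (ratioCoeff u v r))) := by
  set U : Polynomial Fock := Polynomial.monomial 1 (MvPolynomial.C u) with hU
  set W : Polynomial Fock := Polynomial.monomial 1 (MvPolynomial.C v) with hW
  have hUp : ∀ k, U ^ k = Polynomial.monomial k (MvPolynomial.C (u ^ k)) := by
    intro k; simp [hU, Polynomial.monomial_pow]
  have hWp : ∀ k, W ^ k = Polynomial.monomial k (MvPolynomial.C (v ^ k)) := by
    intro k; simp [hW, Polynomial.monomial_pow]
  have h := (IsExpSeries.geometric U).mul (IsExpSeries.geometric_inv W)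
  convert h using 1
  · ext1 k
    rw [hUp, hWp]
    simp [sub_eq_add_neg]
  · ext1 n
    rw [mul_sub, mul_one, map_sub, mul_left_comm, PowerSeries.coeff_C_mul]
    cases n with
    | zero => simp [ratioCoeff]
    | succ n =>
      simp only [PowerSeries.coeff_mk, PowerSeries.coeff_succ_mul_X, ratioCoeff]
      rw [hUp, hUp, hW, Polynomial.monomial_mul_monomial, add_comm 1 n, ← map_sub]
      congr 1
      rw [← map_mul, ← map_sub]
      congr 1
      ring

/-- If the power sums of `G` are `a_k q_k`, a shift multiplies `G` by the ratio
`(1 - v Y t) / (1 - u Y t)` as soon as `a_k τ_k = u^k - v^k`. -/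
theorem shift_coeff_isExpSeries {a τ : ℕ+ → ℂ} {u v : ℂ} {G : PowerSeries Fock}
    (hG : IsExpSeries (fun k => MvPolynomial.C (a (Nat.toPNat' k)) *
      MvPolynomial.X (Nat.toPNat' k)) G)
    (h : ∀ k : ℕ+, a k * τ k = u ^ (k : ℕ) - v ^ (k : ℕ)) (n : ℕ) :
    shift τ (PowerSeries.coeff n G) = ∑ p ∈ Finset.HasAntidiagonal.antidiagonal n,
      Polynomial.monomial p.1 (MvPolynomial.C (ratioCoeff u v p.1) * PowerSeries.coeff p.2 G) := by
  have h1 := hG.map (shift τ : Fock →+* Polynomial Fock)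
  have h2 := (isExpSeries_ratio u v).mul (hG.map (Polynomial.C : Fock →+* Polynomial Fock))
  have h3 := h1.unique h2 fun k => by
    have hk : ((Nat.toPNat' (k + 1) : ℕ+) : ℕ) = k + 1 := by simp
    have hh := h (Nat.toPNat' (k + 1))
    rw [hk] at hh
    rw [RingHom.coe_coe, map_mul, shift_X, shift_C, ← hh, hk, mul_add, Polynomial.C_mul_monomial,
      ← map_mul, ← map_mul, add_comm]
  have h4 := congrArg (PowerSeries.coeff n) h3
  rw [PowerSeries.coeff_map, PowerSeries.coeff_mul] at h4
  refine h4.trans (Finset.sum_congr rfl fun p _ => ?_)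
  rw [PowerSeries.coeff_mk, PowerSeries.coeff_map, mul_comm, Polynomial.C_mul_monomial, mul_comm]

/-- A shift with `τ_k = u^k - v^k` multiplies `∑ h_k t^k` by `(1 - v Y t) / (1 - u Y t)`. -/
theorem shift_hPoly {τ : ℕ+ → ℂ} {u v : ℂ}
    (h : ∀ k : ℕ+, τ k = u ^ (k : ℕ) - v ^ (k : ℕ)) (n : ℕ) :
    shift τ (hPoly n) = ∑ p ∈ Finset.HasAntidiagonal.antidiagonal n,
      Polynomial.monomial p.1 (MvPolynomial.C (ratioCoeff u v p.1) * hPoly p.2) := by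
  have h1 : IsExpSeries (fun k => MvPolynomial.C ((1 : ℕ+ → ℂ) (Nat.toPNat' k)) *
      MvPolynomial.X (Nat.toPNat' k)) hSeries := by
    have : (fun k => (MvPolynomial.C ((1 : ℕ+ → ℂ) (Nat.toPNat' k)) *
        MvPolynomial.X (Nat.toPNat' k) : Fock)) = fun k => MvPolynomial.X (Nat.toPNat' k) := by
      funext k
      rw [Pi.one_apply, map_one, one_mul]
    rw [this]
    exact isExpSeries_hSeries
  have h2 : ∀ k : ℕ+, (1 : ℕ+ → ℂ) k * τ k = u ^ (k : ℕ) - v ^ (k : ℕ) := fun k => by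
    rw [Pi.one_apply, one_mul, h]
  rw [hPoly_natCast, shift_coeff_isExpSeries h1 h2]
  exact Finset.sum_congr rfl fun p _ => by rw [hPoly_natCast]

theorem shift_neg_one_hPoly (k : ℤ) : shift (fun _ => -1) (hPoly k) =
    Polynomial.C (hPoly k) - Polynomial.X * Polynomial.C (hPoly (k - 1)) := by
  rcases lt_trichotomy k 0 with hk | rfl | hk
  · rw [hPoly_of_neg hk, hPoly_of_neg (by omega)]; simp
  · rw [hPoly_zero, hPoly_of_neg (by omega)]; simp
  · obtain ⟨n, rfl⟩ : ∃ n : ℕ, k = ((n + 1 : ℕ) : ℤ) := ⟨(k - 1).toNat, by omega⟩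
    have : (((n + 1 : ℕ) : ℤ) - 1) = (n : ℤ) := by push_cast; ring
    rw [this, shift_hPoly (u := 0) (v := 1) (fun k => by simp),
      Finset.Nat.antidiagonal_succ, Finset.sum_cons, Finset.sum_map,
      Finset.sum_eq_single (0, n)]
    · have h1 : ratioCoeff 0 1 1 = -1 := by simp [ratioCoeff]
      change Polynomial.monomial 0 (MvPolynomial.C 1 * hPoly ((n + 1 : ℕ) : ℤ)) +
        Polynomial.monomial 1 (MvPolynomial.C (ratioCoeff 0 1 1) * hPoly (n : ℤ)) = _
      rw [h1, Polynomial.X_mul_C, Polynomial.C_mul_X_eq_monomial, Polynomial.monomial_zero_left]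
      simp [sub_eq_add_neg]
    · rintro ⟨i, j⟩ hp hne
      cases i with
      | zero => exact absurd (by simpa using hp) hne
      | succ i => simp [ratioCoeff]
    · simp

/-! ### The vertex operator and the Bernstein operators -/

/-- The numbers `b^k - b^{-k}`. -/
def expDiff (b : ℂ) (k : ℕ+) : ℂ := b ^ (k : ℕ) - b⁻¹ ^ (k : ℕ)

/-- The coefficient of `X^n` in `exp (∑_k (b^k - b^{-k}) q_k X^k / k)`. -/
def vertexCoeff (b : ℂ) : ℕ → Fock :=
  expCoeff fun k => MvPolynomial.C (expDiff b k / (k : ℕ)) * MvPolynomial.X k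

/-- The constant term in `X` of
`exp (∑_k (b^k - b^{-k}) q_k X^k / k) exp (∑_k (b^k - b^{-k}) X^{-k} ∂/∂q_k)`; the second factor
is the shift `q_k ↦ q_k + (b^k - b^{-k}) X^{-k}`. -/
def vertexOp (b : ℂ) : Fock →ₗ[ℂ] Fock := shiftPairing (vertexCoeff b) (expDiff b)

/-- The Bernstein operator `f ↦ ∑_i h_{m+i} [Y^i] f(q_k - Y^k)`. -/
def bernstein (m : ℤ) : Fock →ₗ[ℂ] Fock := shiftPairing (fun i => hPoly (m + i)) fun _ => -1

theorem isExpSeries_vertexCoeff (b : ℂ) :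
    IsExpSeries (fun k => MvPolynomial.C (expDiff b (Nat.toPNat' k)) *
      (MvPolynomial.X (Nat.toPNat' k) : Fock)) (PowerSeries.mk (vertexCoeff b)) := by
  refine (isExpSeries_expCoeff _).congr fun n => ?_
  have h0 : ((n + 1 : ℕ) : ℂ) ≠ 0 := by exact_mod_cast n.succ_ne_zero
  have h1 : ((Nat.toPNat' (n + 1) : ℕ+) : ℕ) = n + 1 := by simp
  rw [← mul_assoc, ← map_natCast (MvPolynomial.C : ℂ →+* Fock), ← map_mul, h1,
    mul_div_cancel₀ _ h0]

/-- The identity `F(bt) H(t) = H(b² t)` for `F(X) = H(bX) / H(X/b)`. -/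
theorem sum_vertexCoeff_mul_hPoly {b : ℂ} (hb : b ≠ 0) (N : ℕ) :
    ∑ p ∈ Finset.HasAntidiagonal.antidiagonal N,
      (MvPolynomial.C (b ^ p.1) * vertexCoeff b p.1) * hPoly p.2 =
    MvPolynomial.C (b ^ (2 * N)) * hPoly N := by
  have h1 := ((isExpSeries_vertexCoeff b).rescale (MvPolynomial.C b)).mul isExpSeries_hSeries
  have h2 := isExpSeries_hSeries.rescale (MvPolynomial.C (b ^ 2))
  have h3 := h1.unique h2 fun n => by
    have h1 : ((Nat.toPNat' (n + 1) : ℕ+) : ℕ) = n + 1 := by simp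
    rw [← mul_assoc, ← map_pow, ← map_mul, ← map_pow, expDiff, h1, mul_sub, ← mul_pow, ← mul_pow,
      mul_inv_cancel₀ hb, one_pow, map_sub, sub_mul, map_one, one_mul, sub_add_cancel, sq]
  have h4 := congrArg (PowerSeries.coeff N) h3
  rw [PowerSeries.coeff_mul, PowerSeries.coeff_rescale, ← map_pow, ← pow_mul] at h4
  rw [hPoly_natCast, ← h4]
  refine Finset.sum_congr rfl fun p _ => ?_
  rw [PowerSeries.coeff_rescale, ← map_pow, PowerSeries.coeff_mk, hPoly_natCast]

theorem ratioCoeff_inv_right {b : ℂ} (hb : b ≠ 0) (r : ℕ) :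
    ratioCoeff b b⁻¹ r = (1 - b⁻¹ ^ 2) * b ^ r + if r = 0 then b⁻¹ ^ 2 else 0 := by
  cases r with
  | zero => simp [ratioCoeff]
  | succ r => simp only [ratioCoeff, r.succ_ne_zero, if_false]; field_simp; ring

theorem ratioCoeff_inv_left {b : ℂ} (hb : b ≠ 0) (r : ℕ) :
    b⁻¹ ^ 2 * ratioCoeff b⁻¹ b r = -((1 - b⁻¹ ^ 2) * b⁻¹ ^ r) + if r = 0 then 1 else 0 := by
  cases r with
  | zero => simp [ratioCoeff]
  | succ r =>
    simp only [ratioCoeff, r.succ_ne_zero, if_false, pow_succ]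
    linear_combination -b⁻¹ * b⁻¹ ^ r * mul_inv_cancel₀ hb

theorem sum_range_succ_ite (M : ℕ) (G : ℕ → Fock) (s : ℕ → ℂ) (a : ℂ) :
    ∑ r ∈ Finset.range (M + 1), MvPolynomial.C (s r + if r = 0 then a else 0) * G r =
      ∑ r ∈ Finset.range (M + 1), MvPolynomial.C (s r) * G r + MvPolynomial.C a * G 0 := by
  simp only [map_add, add_mul, Finset.sum_add_distrib]
  congr 1
  rw [Finset.sum_eq_single 0]
  · simp
  · intro r _ hr; simp [hr]
  · simp

theorem sum_vertexCoeff_mul_hPoly_split {b : ℂ} (hb : b ≠ 0) (n M : ℕ) :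
    ∑ r ∈ Finset.range (M + 1),
      MvPolynomial.C (b ^ r) * (vertexCoeff b (n + r) * hPoly ((M - r : ℕ) : ℤ)) +
    ∑ r ∈ Finset.range (n + 1),
      MvPolynomial.C (b⁻¹ ^ r) * (vertexCoeff b (n - r) * hPoly ((M + r : ℕ) : ℤ)) =
    MvPolynomial.C (b ^ (2 * M + n)) * hPoly ((M + n : ℕ) : ℤ) + vertexCoeff b n * hPoly M := by
  have hpow : ∀ k, b⁻¹ ^ k * b ^ k = 1 := fun k => by rw [← mul_pow, inv_mul_cancel₀ hb, one_pow]
  have hres := congrArg (MvPolynomial.C (b⁻¹ ^ n) * ·) (sum_vertexCoeff_mul_hPoly hb (M + n))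
  rw [Finset.Nat.sum_antidiagonal_eq_sum_range_succ_mk,
    show (M + n).succ = n + (M + 1) by omega, Finset.sum_range_add, mul_add, Finset.mul_sum,
    Finset.mul_sum, ← mul_assoc, ← map_mul,
    show b⁻¹ ^ n * b ^ (2 * (M + n)) = b ^ (2 * M + n) by
      linear_combination b ^ (2 * M + n) * hpow n] at hres
  rw [← hres, Finset.sum_range_succ' _ n, ← Finset.sum_range_reflect _ n]
  have e1 : ∀ x ∈ Finset.range n, MvPolynomial.C (b⁻¹ ^ (n - 1 - x + 1)) *
      (vertexCoeff b (n - (n - 1 - x + 1)) * hPoly ((M + (n - 1 - x + 1) : ℕ) : ℤ)) =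
      MvPolynomial.C (b⁻¹ ^ n) *
        (MvPolynomial.C (b ^ x) * vertexCoeff b x * hPoly ((M + n - x : ℕ) : ℤ)) := by
    intro x hx
    have hx := Finset.mem_range.1 hx
    obtain ⟨d, rfl⟩ : ∃ d, n = x + 1 + d := ⟨n - x - 1, by omega⟩
    rw [show x + 1 + d - 1 - x + 1 = d + 1 by omega, show x + 1 + d - (d + 1) = x by omega,
      show M + (x + 1 + d) - x = M + (d + 1) by omega,
      show b⁻¹ ^ (d + 1) = b⁻¹ ^ (x + 1 + d) * b ^ x by
        linear_combination -b⁻¹ ^ (d + 1) * hpow x, map_mul]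
    ring
  have e2 : ∀ x ∈ Finset.range (M + 1), MvPolynomial.C (b ^ x) *
      (vertexCoeff b (n + x) * hPoly ((M - x : ℕ) : ℤ)) = MvPolynomial.C (b⁻¹ ^ n) *
        (MvPolynomial.C (b ^ (n + x)) * vertexCoeff b (n + x) *
          hPoly ((M + n - (n + x) : ℕ) : ℤ)) := by
    intro x hx
    rw [show M + n - (n + x) = M - x by omega,
      show b ^ x = b⁻¹ ^ n * b ^ (n + x) by linear_combination -b ^ x * hpow n, map_mul]
    ring
  rw [Finset.sum_congr rfl e1, Finset.sum_congr rfl e2]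
  simp only [pow_zero, map_one, one_mul, Nat.sub_zero, add_zero]
  ring

/-- The coefficient form of `H(b X) / H(X / b) · H(t)` at `X = b t`: the contributions of the two
expansions of a simple pole at `X = b t` differ by its residue. -/
theorem vertexCoeff_hPoly_residue {b : ℂ} (hb : b ≠ 0) (n M : ℕ) :
    ∑ p ∈ Finset.HasAntidiagonal.antidiagonal M,
      vertexCoeff b (n + p.1) * (MvPolynomial.C (ratioCoeff b b⁻¹ p.1) * hPoly p.2) =
    MvPolynomial.C (b⁻¹ ^ 2) * ∑ p ∈ Finset.HasAntidiagonal.antidiagonal n,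
      hPoly ((M + p.1 : ℕ) : ℤ) * (MvPolynomial.C (ratioCoeff b⁻¹ b p.1) * vertexCoeff b p.2) +
    MvPolynomial.C ((1 - b⁻¹ ^ 2) * b ^ (2 * M + n)) * hPoly ((M + n : ℕ) : ℤ) := by
  have e1 := sum_range_succ_ite M (fun r => vertexCoeff b (n + r) * hPoly ((M - r : ℕ) : ℤ))
    (fun r => (1 - b⁻¹ ^ 2) * b ^ r) (b⁻¹ ^ 2)
  have e2 := sum_range_succ_ite n (fun r => vertexCoeff b (n - r) * hPoly ((M + r : ℕ) : ℤ))
    (fun r => -((1 - b⁻¹ ^ 2) * b⁻¹ ^ r)) 1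
  simp only [← ratioCoeff_inv_right hb, ← ratioCoeff_inv_left hb, map_neg, map_mul, mul_assoc,
    neg_mul, Finset.sum_neg_distrib, ← Finset.mul_sum] at e1 e2
  have hs := sum_vertexCoeff_mul_hPoly_split hb n M
  rw [Finset.Nat.sum_antidiagonal_eq_sum_range_succ_mk,
    Finset.Nat.sum_antidiagonal_eq_sum_range_succ_mk]
  simp only [mul_left_comm (vertexCoeff b _) (MvPolynomial.C _),
    mul_left_comm (hPoly _) (MvPolynomial.C _), mul_comm (hPoly _) (vertexCoeff b _)]
  simp only [Nat.succ_eq_add_one, Nat.sub_zero, add_zero, map_one, one_mul, map_mul] at e1 e2 ⊢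
  rw [e1, e2]
  linear_combination MvPolynomial.C (1 - b⁻¹ ^ 2) * hs +
    (vertexCoeff b n * hPoly M) * (by rw [← map_add, sub_add_cancel, map_one] :
      (MvPolynomial.C (1 - b⁻¹ ^ 2) + MvPolynomial.C (b⁻¹ ^ 2) : Fock) = 1)

theorem sum_range_antidiagonal {A : Type*} [AddCommMonoid A] {G : ℕ → ℕ → A} {N : ℕ}
    (hG : ∀ n i, N ≤ n ∨ N ≤ i → G n i = 0) :
    ∑ j ∈ Finset.range (2 * N), ∑ p ∈ Finset.HasAntidiagonal.antidiagonal j, G p.1 p.2 =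
      ∑ n ∈ Finset.range N, ∑ i ∈ Finset.range N, G n i := by
  rw [← Finset.sum_product' , ← Finset.sum_fiberwise_of_maps_to (t := Finset.range (2 * N))
    (g := fun p : ℕ × ℕ => p.1 + p.2)]
  · refine Finset.sum_congr rfl fun j _ => (Finset.sum_subset ?_ ?_).symm
    · intro p hp
      simpa using (Finset.mem_filter.1 hp).2
    · intro p hp hp'
      refine hG _ _ ?_
      by_contra h
      push Not at h
      exact hp' (Finset.mem_filter.2 ⟨Finset.mk_mem_product (Finset.mem_range.2 h.1)
        (Finset.mem_range.2 h.2), by simpa using hp⟩)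
  · intro p hp
    simp only [Finset.mem_product, Finset.mem_range] at hp ⊢
    omega

theorem shift_expDiff_hPoly (b : ℂ) (n : ℕ) :
    shift (expDiff b) (hPoly n) = ∑ p ∈ Finset.HasAntidiagonal.antidiagonal n,
      Polynomial.monomial p.1 (MvPolynomial.C (ratioCoeff b b⁻¹ p.1) * hPoly p.2) :=
  shift_hPoly (fun _ => rfl) n

theorem shift_neg_one_vertexCoeff (b : ℂ) (n : ℕ) :
    shift (fun _ => -1) (vertexCoeff b n) = ∑ p ∈ Finset.HasAntidiagonal.antidiagonal n,
      Polynomial.monomial p.1 (MvPolynomial.C (ratioCoeff b⁻¹ b p.1) * vertexCoeff b p.2) := by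
  have := shift_coeff_isExpSeries (u := b⁻¹) (v := b) (τ := fun _ => -1) (isExpSeries_vertexCoeff b)
    (fun k => by simp [expDiff]) n
  simpa using this

/-- The relation `V_b B_m = b^{-2} B_m V_b + (1 - b^{-2}) b^{2m} B_m`. Both sides are expanded in the
commuting shift coefficients, and compared by `vertexCoeff_hPoly_residue`. -/
theorem vertexOp_bernstein {b : ℂ} (hb : b ≠ 0) (m : ℕ) (f : Fock) :
    vertexOp b (bernstein m f) = b⁻¹ ^ 2 • bernstein m (vertexOp b f) +
      ((1 - b⁻¹ ^ 2) * b ^ (2 * m)) • bernstein m f := by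
  obtain ⟨N, hN⟩ := exists_shiftCoeff_shiftCoeff_eq_zero (expDiff b) (fun _ => -1) f
  have hS : ∀ i, N ≤ i → shiftCoeff (fun _ => -1) i f = 0 := fun i hi => by
    rw [← shiftCoeff_zero (expDiff b) (shiftCoeff _ i f), hN _ _ (Or.inr hi)]
  have hD : ∀ n, N ≤ n → shiftCoeff (expDiff b) n f = 0 := fun n hn => by
    rw [← shiftCoeff_zero (fun _ => -1) (shiftCoeff _ n f), shiftCoeff_comm, hN _ _ (Or.inl hn)]
  have hcast : ∀ i : ℕ, (m : ℤ) + (i : ℤ) = ((m + i : ℕ) : ℤ) := fun i => by push_cast; rfl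
  set T : ℕ → ℕ → Fock := fun n i => shiftCoeff (expDiff b) n (shiftCoeff (fun _ => -1) i f) with hT
  have hL : vertexOp b (bernstein m f) = ∑ n ∈ Finset.range N, ∑ i ∈ Finset.range N,
      T n i * ∑ p ∈ Finset.HasAntidiagonal.antidiagonal (m + i), vertexCoeff b (n + p.1) *
        (MvPolynomial.C (ratioCoeff b b⁻¹ p.1) * hPoly p.2) := by
    rw [bernstein, shiftPairing_eq_sum _ _ _ hS, map_sum, Finset.sum_comm]
    refine Finset.sum_congr rfl fun i _ => ?_
    rw [vertexOp, shiftPairing_apply, map_mul, hcast, shift_expDiff_hPoly, Finset.mul_sum, map_sum]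
    simp only [pairing_mul_monomial, Finset.mul_sum]
    rw [Finset.sum_comm]
    refine Finset.sum_congr rfl fun p _ => ?_
    rw [← shiftPairing_apply, shiftPairing_eq_sum _ _ _ (fun n hn => hN n i (Or.inl hn)),
      Finset.sum_mul]
    exact Finset.sum_congr rfl fun n _ => by rw [mul_assoc]
  have hR : bernstein m (vertexOp b f) = ∑ n ∈ Finset.range N, ∑ i ∈ Finset.range N,
      T n i * ∑ p ∈ Finset.HasAntidiagonal.antidiagonal n, hPoly ((m + i + p.1 : ℕ) : ℤ) *
        (MvPolynomial.C (ratioCoeff b⁻¹ b p.1) * vertexCoeff b p.2) := by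
    rw [vertexOp, shiftPairing_eq_sum _ _ _ hD, map_sum]
    refine Finset.sum_congr rfl fun n _ => ?_
    rw [bernstein, shiftPairing_apply, map_mul, shift_neg_one_vertexCoeff, Finset.mul_sum, map_sum]
    simp only [pairing_mul_monomial, Finset.mul_sum]
    rw [Finset.sum_comm]
    refine Finset.sum_congr rfl fun p _ => ?_
    rw [← shiftPairing_apply, shiftPairing_eq_sum _ _ _
      (fun i hi => (shiftCoeff_comm _ _ _ _ _).trans (hN n i (Or.inr hi))), Finset.sum_mul]
    refine Finset.sum_congr rfl fun i _ => ?_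
    rw [shiftCoeff_comm, mul_assoc, hcast, add_assoc]
  have hB : bernstein m f = ∑ n ∈ Finset.range N, ∑ i ∈ Finset.range N,
      T n i * (MvPolynomial.C (b ^ (2 * i + n)) * hPoly ((m + i + n : ℕ) : ℤ)) := by
    rw [bernstein, shiftPairing_eq_sum (N := 2 * N) _ _ _ (fun n hn => hS n (by omega)),
      ← sum_range_antidiagonal (fun n i h => by rw [hT]; simp only; rw [hN n i h, zero_mul])]
    refine Finset.sum_congr rfl fun j _ => ?_
    -- At `T = b Y` the two shifts combine to `q_k ↦ q_k - (Y / b)^k`.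
    have h := sum_shiftCoeff_shiftCoeff (expDiff b) (fun _ => -1) b j f
    have hτ : (fun k => expDiff b k + b ^ (k : ℕ) * -1) = fun k : ℕ+ => b⁻¹ ^ (k : ℕ) * -1 := by
      funext k; rw [expDiff]; ring
    rw [hτ, shiftCoeff_scale] at h
    have h2 : shiftCoeff (fun _ => -1) j f = b ^ j • b⁻¹ ^ j • shiftCoeff (fun _ => -1) j f := by
      rw [smul_smul, ← mul_pow, mul_inv_cancel₀ hb, one_pow, one_smul]
    rw [h2, ← h, Finset.smul_sum, Finset.sum_mul]
    refine Finset.sum_congr rfl fun p hp => ?_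
    have hp := Finset.HasAntidiagonal.mem_antidiagonal.1 hp
    rw [smul_smul, MvPolynomial.smul_eq_C_mul, ← pow_add, hcast, ← hp,
      show p.1 + p.2 + p.2 = 2 * p.2 + p.1 by ring, show m + (p.1 + p.2) = m + p.2 + p.1 by ring]
    ring
  rw [hL, hR, hB, MvPolynomial.smul_eq_C_mul, MvPolynomial.smul_eq_C_mul, Finset.mul_sum,
    Finset.mul_sum, ← Finset.sum_add_distrib]
  refine Finset.sum_congr rfl fun n _ => ?_
  rw [Finset.mul_sum, Finset.mul_sum, ← Finset.sum_add_distrib]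
  refine Finset.sum_congr rfl fun i _ => ?_
  rw [vertexCoeff_hPoly_residue hb,
    show (1 - b⁻¹ ^ 2) * b ^ (2 * (m + i) + n) = (1 - b⁻¹ ^ 2) * b ^ (2 * m) * b ^ (2 * i + n) by
      ring, map_mul _ ((1 - b⁻¹ ^ 2) * b ^ (2 * m))]
  ring

/-! ### Jacobi–Trudi determinants -/

/-- The determinant `det (h_{γ_i + j})`, `0 ≤ i, j < l`, for arbitrary integers `γ_i`. The Schur
polynomial of `λ` is the case `γ_i = λ_{i+1} - i`. -/
def jacobiTrudi {l : ℕ} (γ : Fin l → ℤ) : Fock :=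
  Matrix.det (Matrix.of fun i j : Fin l => hPoly (γ i + (j : ℕ)))

theorem bernstein_jacobiTrudi {l : ℕ} (m : ℤ) (γ : Fin l → ℤ) :
    bernstein m (jacobiTrudi γ) = jacobiTrudi (Fin.cons m fun i => γ i - 1 : Fin (l + 1) → ℤ) := by
  set A : Matrix (Fin (l + 1)) (Fin (l + 1)) (Polynomial Fock) :=
    Matrix.of (Fin.cons (fun j => Polynomial.X ^ (j : ℕ))
      fun i j => Polynomial.C (hPoly (γ i - 1 + (j : ℕ)))) with hA
  set B : Matrix (Fin (l + 1)) (Fin (l + 1)) (Polynomial Fock) :=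
    Matrix.of (Fin.cons (fun j => if j = 0 then 1 else 0)
      fun i j => if j = 0 then Polynomial.C (hPoly (γ i - 1)) else
        Polynomial.C (hPoly (γ i - 1 + (j : ℕ))) -
          Polynomial.X * Polynomial.C (hPoly (γ i - 1 + (j : ℕ) - 1))) with hB
  have h1 : A.det = B.det := by
    refine Matrix.det_eq_of_forall_col_eq_smul_add_pred (fun _ => Polynomial.X) (fun i => ?_)
      fun i j => ?_
    · refine Fin.cases ?_ (fun i => ?_) i <;> simp [hA, hB]
    · refine Fin.cases ?_ (fun i => ?_) i
      · simp [hA, hB, pow_succ']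
      · simp [hA, hB]
        ring_nf
  have h2 : B.det = shift (fun _ => -1) (jacobiTrudi γ) := by
    rw [Matrix.det_succ_row_zero, Fin.sum_univ_succ, jacobiTrudi, AlgHom.map_det]
    simp only [hB, Matrix.of_apply, Fin.cons_zero, Fin.succ_ne_zero, if_false, mul_zero, zero_mul,
      Finset.sum_const_zero, add_zero, if_true, Fin.val_zero, pow_zero, one_mul]
    congr 1
    ext1 i j
    simp only [Matrix.submatrix_apply, Matrix.of_apply, Fin.cons_succ, Fin.zero_succAbove,
      Fin.succ_ne_zero, if_false, AlgHom.mapMatrix_apply, Matrix.map_apply, shift_neg_one_hPoly,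
      Fin.val_succ]
    push_cast
    rw [show γ i - 1 + ((j : ℕ) + 1 : ℤ) = γ i + (j : ℕ) by ring]
  rw [bernstein, shiftPairing_apply, ← h2, ← h1, Matrix.det_succ_row_zero, map_sum, jacobiTrudi,
    Matrix.det_succ_row_zero]
  refine Finset.sum_congr rfl fun j _ => ?_
  have h3 : (A.submatrix Fin.succ j.succAbove).det = Polynomial.C
      ((Matrix.of fun i j : Fin (l + 1) => hPoly ((Fin.cons m fun i => γ i - 1 : Fin (l + 1) → ℤ) i
        + (j : ℕ))).submatrix Fin.succ j.succAbove).det := by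
    rw [RingHom.map_det]
    congr 1
  have h4 : (-1 : Polynomial Fock) ^ (j : ℕ) * A 0 j =
      Polynomial.monomial (j : ℕ) ((-1 : Fock) ^ (j : ℕ)) := by
    simp [hA, ← Polynomial.C_mul_X_pow_eq_monomial]
  rw [h3, h4, mul_comm, Polynomial.C_mul_monomial, pairing_monomial]
  simp only [Matrix.of_apply, Fin.cons_zero]
  ring

theorem jacobiTrudi_succ {l : ℕ} (γ : Fin (l + 1) → ℤ) :
    jacobiTrudi γ = bernstein (γ 0) (jacobiTrudi fun i => γ i.succ + 1) := by
  rw [bernstein_jacobiTrudi]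
  congr 1
  simp only [add_sub_cancel_right]
  exact (Fin.cons_self_tail γ).symm

theorem jacobiTrudi_of_isEmpty (γ : Fin 0 → ℤ) : jacobiTrudi γ = 1 := by
  simp [jacobiTrudi]

theorem vertexOp_one (b : ℂ) : vertexOp b 1 = 1 := by
  have h : ∀ n, 1 ≤ n → shiftCoeff (expDiff b) n 1 = 0 := fun n hn => by
    rw [← map_one MvPolynomial.C, shiftCoeff_C, if_neg (by omega)]
  have h0 := (isExpSeries_vertexCoeff b).coeff_zero
  rw [PowerSeries.coeff_mk] at h0
  rw [vertexOp, shiftPairing_eq_sum _ _ _ h]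
  simp [shiftCoeff_zero, h0]

/-- The eigenvalue of the vertex operator on a Jacobi–Trudi determinant. -/
theorem vertexOp_jacobiTrudi {b : ℂ} (hb : b ≠ 0) {l : ℕ} (α : Fin l → ℕ) :
    vertexOp b (jacobiTrudi fun i => (α i : ℤ) - (i : ℕ)) =
      (b⁻¹ ^ (2 * l) + (1 - b⁻¹ ^ 2) * ∑ i, b ^ (2 * α i) * b⁻¹ ^ (2 * (i : ℕ))) •
        jacobiTrudi fun i => (α i : ℤ) - (i : ℕ) := by
  induction l with
  | zero => simp [jacobiTrudi_of_isEmpty, vertexOp_one]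
  | succ l ih =>
    have h : (fun i : Fin l => (α i.succ : ℤ) - (i.succ : ℕ) + 1) =
        fun i : Fin l => (α i.succ : ℤ) - (i : ℕ) := by
      funext i
      rw [Fin.val_succ]
      push_cast; ring
    have h0 : (α 0 : ℤ) - ((0 : Fin (l + 1)) : ℕ) = (α 0 : ℕ) := by simp
    rw [jacobiTrudi_succ, h, h0, vertexOp_bernstein hb, ih, map_smul, smul_smul, ← add_smul]
    congr 1
    rw [Fin.sum_univ_succ]
    simp only [Fin.val_succ, Fin.val_zero]
    have : ∀ i : Fin l, b ^ (2 * α i.succ) * b⁻¹ ^ (2 * ((i : ℕ) + 1)) =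
        b⁻¹ ^ 2 * (b ^ (2 * α i.succ) * b⁻¹ ^ (2 * (i : ℕ))) := fun i => by ring
    simp only [this, ← Finset.mul_sum]
    ring

/-! ### Schur polynomials span the Fock space -/

theorem schur_eq_jacobiTrudi (lam : YoungDiagram) :
    schur lam = jacobiTrudi fun i : Fin (lam.colLen 0) => (lam.rowLen i : ℤ) - (i : ℕ) := rfl

theorem jacobiTrudi_append_zero {l : ℕ} (γ : Fin (l + 1) → ℤ) (h : γ (Fin.last l) = -l) :
    jacobiTrudi γ = jacobiTrudi fun i : Fin l => γ i.castSucc := by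
  rw [jacobiTrudi, Matrix.det_succ_row _ (Fin.last l), Finset.sum_eq_single (Fin.last l)]
  · have h1 : ((-1 : Fock)) ^ (l + l) = 1 := (Even.add_self l).neg_one_pow
    simp only [Matrix.of_apply, h, Fin.val_last, neg_add_cancel, hPoly_zero, h1, one_mul,
      Fin.succAbove_last, jacobiTrudi]
    rfl
  · intro j _ hj
    have : (j : ℕ) < l := Fin.val_lt_last hj
    rw [Matrix.of_apply, h, hPoly_of_neg (by omega), mul_zero, zero_mul]
  · simp

/-- Trailing zeros do not change the determinant. -/
theorem jacobiTrudi_eq_schur (lam : YoungDiagram) {l : ℕ} (hl : lam.colLen 0 ≤ l) :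
    jacobiTrudi (fun i : Fin l => (lam.rowLen i : ℤ) - (i : ℕ)) = schur lam := by
  induction l, hl using Nat.le_induction with
  | base => rfl
  | succ l hl ih =>
    rw [jacobiTrudi_append_zero, ← ih]
    · rfl
    · have : lam.rowLen l = 0 := by
        by_contra h
        have := YoungDiagram.mem_iff_lt_colLen.1
          (YoungDiagram.mem_iff_lt_rowLen.2 (Nat.pos_of_ne_zero h))
        omega
      simp [this]

/-- The Young diagram with row lengths `α 0 ≥ α 1 ≥ … ≥ α (l - 1)`. -/
def diagramOfRows (l : ℕ) (α : ℕ → ℕ) (hα : Antitone α) : YoungDiagram where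
  cells := (Finset.range l ×ˢ Finset.range (α 0)).filter fun c => c.2 < α c.1
  isLowerSet := by
    rintro ⟨i, j⟩ ⟨i', j'⟩ h hc
    obtain ⟨h1, h2⟩ := Prod.mk_le_mk.1 h
    simp only [Finset.coe_filter, Finset.mem_product, Finset.mem_range, Set.mem_ofPred_eq] at hc ⊢
    have := hα h1
    have := hα (Nat.zero_le i')
    omega

theorem mem_diagramOfRows {l : ℕ} {α : ℕ → ℕ} {hα : Antitone α} {i j : ℕ} :
    (i, j) ∈ diagramOfRows l α hα ↔ i < l ∧ j < α i := by
  rw [← YoungDiagram.mem_cells]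
  simp only [diagramOfRows, Finset.mem_filter, Finset.mem_product, Finset.mem_range]
  have := hα (Nat.zero_le i)
  omega

theorem rowLen_diagramOfRows {l : ℕ} {α : ℕ → ℕ} {hα : Antitone α} {i : ℕ} (hi : i < l) :
    (diagramOfRows l α hα).rowLen i = α i :=
  eq_of_forall_lt_iff fun j => by
    rw [← YoungDiagram.mem_iff_lt_rowLen, mem_diagramOfRows, and_iff_right hi]

theorem colLen_diagramOfRows_le {l : ℕ} {α : ℕ → ℕ} {hα : Antitone α} :
    (diagramOfRows l α hα).colLen 0 ≤ l := by
  by_contra h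
  have := (mem_diagramOfRows.1 (YoungDiagram.mem_iff_lt_colLen.2 (not_le.1 h))).1
  omega

/-- A Jacobi–Trudi determinant with strictly decreasing `γ` is a Schur polynomial, or it has a zero
row. -/
theorem jacobiTrudi_mem_span_of_strictAnti {l : ℕ} {γ : Fin l → ℤ} (hγ : StrictAnti γ) :
    jacobiTrudi γ ∈ Submodule.span ℂ (Set.range schur) := by
  by_cases h : ∃ i, γ i + l ≤ 0
  · obtain ⟨i, hi⟩ := h
    rw [jacobiTrudi, Matrix.det_eq_zero_of_row_eq_zero i]
    · exact zero_mem _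
    · intro j
      rw [Matrix.of_apply, hPoly_of_neg]
      have := j.2
      omega
  · push Not at h
    have hstep : ∀ i j : Fin l, i ≤ j → γ j + (j : ℕ) ≤ γ i + (i : ℕ) := by
      intro i j hij
      obtain ⟨i, hi⟩ := i
      obtain ⟨j, hj⟩ := j
      have hij' : i ≤ j := hij
      induction j, hij' using Nat.le_induction with
      | base => rfl
      | succ j hij' ih =>
        have h1 : γ ⟨j, by omega⟩ + (j : ℤ) ≤ γ ⟨i, hi⟩ + (i : ℤ) := 
          ih (by omega) (Fin.mk_le_mk.2 hij')
        have h2 : γ ⟨j + 1, hj⟩ < γ ⟨j, by omega⟩ := hγ (by simp [Fin.lt_def])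
        change γ ⟨j + 1, hj⟩ + ((j + 1 : ℕ) : ℤ) ≤ γ ⟨i, hi⟩ + (i : ℤ)
        push_cast
        omega
    have hpos : ∀ i : Fin l, 0 ≤ γ i + (i : ℕ) := by
      intro i
      have hl : l - 1 < l := by have := i.2; omega
      have h1 := hstep i ⟨l - 1, hl⟩ (by rw [Fin.le_def]; have := i.2; simp only; omega)
      have h2 := h ⟨l - 1, hl⟩
      push_cast at h1
      omega
    set α : ℕ → ℕ := fun i => if hi : i < l then (γ ⟨i, hi⟩ + (i : ℕ)).toNat else 0 with hα
    have hanti : Antitone α := by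
      intro i j hij
      simp only [hα]
      split_ifs with h1 h2
      · exact Int.toNat_le_toNat (hstep ⟨i, h2⟩ ⟨j, h1⟩ hij)
      · omega
      · exact Nat.zero_le _
      · exact le_rfl
    refine Submodule.subset_span ⟨diagramOfRows l α hanti, ?_⟩
    rw [← jacobiTrudi_eq_schur _ colLen_diagramOfRows_le]
    congr 1
    funext i
    rw [rowLen_diagramOfRows i.2]
    simp only [hα, i.2, dif_pos, Int.toNat_of_nonneg (hpos i)]
    ring

/-- Sorting the rows turns a Jacobi–Trudi determinant into `± s_λ`, unless it vanishes. -/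
theorem jacobiTrudi_mem_span {l : ℕ} (γ : Fin l → ℤ) :
    jacobiTrudi γ ∈ Submodule.span ℂ (Set.range schur) := by
  by_cases hγ : Function.Injective γ
  · set σ := Tuple.sort fun i => -γ i with hσ
    have h1 : StrictAnti (γ ∘ σ) := by
      have hm : Monotone fun i => -γ (σ i) := Tuple.monotone_sort fun i => -γ i
      have : Antitone (γ ∘ σ) := fun i j hij => by simpa using hm hij
      exact this.strictAnti_of_injective (hγ.comp σ.injective)
    have h2 : jacobiTrudi (γ ∘ σ) = ((Equiv.Perm.sign σ : ℤ) : Fock) * jacobiTrudi γ :=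
      Matrix.det_permute σ (Matrix.of fun i j : Fin l => hPoly (γ i + (j : ℕ)))
    have h3 := jacobiTrudi_mem_span_of_strictAnti h1
    rw [h2] at h3
    rcases Int.units_eq_one_or (Equiv.Perm.sign σ) with h | h <;> simpa [h] using h3
  · simp only [Function.Injective, not_forall] at hγ
    obtain ⟨i, j, hij, hne⟩ := hγ
    rw [jacobiTrudi, Matrix.det_zero_of_row_eq hne]
    · exact zero_mem _
    · funext k; simp [hij]

theorem shiftCoeff_one_hPoly (r : ℕ) (k : ℤ) :
    shiftCoeff (fun _ => 1) r (hPoly k) = hPoly (k - r) := by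
  rcases lt_or_ge k 0 with hk | hk
  · rw [hPoly_of_neg hk, hPoly_of_neg (by omega), map_zero]
  · obtain ⟨n, rfl⟩ := Int.eq_ofNat_of_zero_le hk
    have h1 : ∀ r, ratioCoeff 1 0 r = 1 := fun r => by cases r <;> simp [ratioCoeff]
    rw [shiftCoeff_apply, shift_hPoly (u := 1) (v := 0) (fun k => by simp),
      Polynomial.finsetSum_coeff]
    simp only [Polynomial.coeff_monomial, h1, map_one, one_mul]
    rcases le_or_gt r n with hr | hr
    · rw [Finset.sum_eq_single (r, n - r)]
      · simp [Nat.cast_sub hr]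
      · rintro ⟨i, j⟩ hp hne
        have hp := Finset.HasAntidiagonal.mem_antidiagonal.1 hp
        rw [if_neg]
        rintro rfl
        apply hne
        simp only at hp
        rw [← hp]; simp
      · intro h
        exact absurd (Finset.HasAntidiagonal.mem_antidiagonal.2 (by simp; omega)) h
    · rw [hPoly_of_neg (by omega)]
      refine Finset.sum_eq_zero fun p hp => if_neg ?_
      have hp := Finset.HasAntidiagonal.mem_antidiagonal.1 hp
      omega

/-- The shift `q_k ↦ q_k + Y^k` multiplies `∑ h_k t^k` by `1 / (1 - Yt)`, and it commutes with
the shift in the definition of the Bernstein operators. -/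
theorem shiftCoeff_one_bernstein (i : ℕ) (m : ℤ) (f : Fock) :
    shiftCoeff (fun _ => 1) i (bernstein m f) = ∑ p ∈ Finset.HasAntidiagonal.antidiagonal i,
      bernstein (m - p.2) (shiftCoeff (fun _ => 1) p.1 f) := by
  obtain ⟨N, hN⟩ := exists_shiftCoeff_shiftCoeff_eq_zero (fun _ => 1) (fun _ => -1) f
  have hS : ∀ i, N ≤ i → shiftCoeff (fun _ => -1) i f = 0 := fun i hi => by
    rw [← shiftCoeff_zero (fun _ => 1) (shiftCoeff _ i f), hN _ _ (Or.inr hi)]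
  rw [bernstein, shiftPairing_eq_sum _ _ _ hS, map_sum]
  simp only [shiftCoeff_mul, shiftCoeff_one_hPoly]
  rw [Finset.sum_comm]
  refine Finset.sum_congr rfl fun p _ => ?_
  rw [bernstein, shiftPairing_eq_sum _ _ _
    (fun j hj => (shiftCoeff_comm _ _ _ _ _).trans (hN p.1 j (Or.inr hj)))]
  refine Finset.sum_congr rfl fun j _ => ?_
  rw [shiftCoeff_comm, show m + (j : ℤ) - p.2 = m - p.2 + j by ring]

/-- Multiplication by `h_m` is recovered from the Bernstein operators by undoing their shift. -/
theorem hPoly_mul_eq_sum_bernstein (m : ℤ) (f : Fock) :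
    ∃ N, f * hPoly m = ∑ i ∈ Finset.range N, bernstein (m + i) (shiftCoeff (fun _ => 1) i f) := by
  obtain ⟨N, hN⟩ := exists_shiftCoeff_shiftCoeff_eq_zero (fun _ => -1) (fun _ => 1) f
  have h1 : ∀ i : ℕ, bernstein (m + i) (shiftCoeff (fun _ => 1) i f) = ∑ n ∈ Finset.range N,
      shiftCoeff (fun _ => -1) n (shiftCoeff (fun _ => 1) i f) * hPoly (m + (n + i : ℕ)) := by
    intro i
    rw [bernstein, shiftPairing_eq_sum _ _ _ (fun n hn => hN n i (Or.inl hn))]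
    refine Finset.sum_congr rfl fun n _ => ?_
    push_cast
    rw [add_assoc m, add_comm (i : ℤ)]
  refine ⟨N, ?_⟩
  simp only [h1]
  rw [Finset.sum_comm, ← sum_range_antidiagonal (fun n i h => by rw [hN n i h, zero_mul])]
  have h2 : ∀ j, ∑ p ∈ Finset.HasAntidiagonal.antidiagonal j,
      shiftCoeff (fun _ => -1) p.1 (shiftCoeff (fun _ => 1) p.2 f) * hPoly (m + (p.1 + p.2 : ℕ)) =
      if j = 0 then f * hPoly m else 0 := by
    intro j
    have h := sum_shiftCoeff_shiftCoeff (fun _ => -1) (fun _ => 1) 1 j f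
    simp only [one_pow, one_smul, one_mul, neg_add_cancel, shiftCoeff_zero_left] at h
    have h3 : ∀ p ∈ Finset.HasAntidiagonal.antidiagonal j,
        shiftCoeff (fun _ => -1) p.1 (shiftCoeff (fun _ => 1) p.2 f) * hPoly (m + (p.1 + p.2 : ℕ)) =
        shiftCoeff (fun _ => -1) p.1 (shiftCoeff (fun _ => 1) p.2 f) * hPoly (m + j) := by
      intro p hp
      rw [Finset.HasAntidiagonal.mem_antidiagonal.1 hp]
    rw [Finset.sum_congr rfl h3, ← Finset.sum_mul, h]
    split_ifs with hj
    · simp [hj]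
    · rw [zero_mul]
  simp only [h2]
  rw [Finset.sum_ite_eq']
  split_ifs with h0
  · rfl
  · have : N = 0 := by simpa using h0
    have hf : f = 0 := by
      rw [← shiftCoeff_zero (fun _ => -1) f, ← shiftCoeff_zero (fun _ => 1) f]
      exact hN 0 0 (Or.inl this.le)
    rw [hf, zero_mul]

/-- The span of all Jacobi–Trudi determinants. -/
def jacobiTrudiSpan : Submodule ℂ Fock :=
  Submodule.span ℂ (Set.range fun x : Σ l, Fin l → ℤ => jacobiTrudi x.2)

theorem bernstein_mem_jacobiTrudiSpan (m : ℤ) {f : Fock} (hf : f ∈ jacobiTrudiSpan) :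
    bernstein m f ∈ jacobiTrudiSpan := by
  induction hf using Submodule.span_induction with
  | mem f hf =>
    obtain ⟨⟨l, γ⟩, rfl⟩ := hf
    rw [bernstein_jacobiTrudi]
    exact Submodule.subset_span ⟨⟨l + 1, _⟩, rfl⟩
  | zero => simp
  | add f g _ _ hf hg => rw [map_add]; exact add_mem hf hg
  | smul a f _ hf => rw [map_smul]; exact Submodule.smul_mem _ _ hf

theorem shiftCoeff_one_mem_jacobiTrudiSpan (i : ℕ) {f : Fock} (hf : f ∈ jacobiTrudiSpan) :
    shiftCoeff (fun _ => 1) i f ∈ jacobiTrudiSpan := by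
  induction hf using Submodule.span_induction with
  | mem f hf =>
    obtain ⟨⟨l, γ⟩, rfl⟩ := hf
    simp only
    induction l generalizing i with
    | zero =>
      rw [jacobiTrudi_of_isEmpty, ← map_one MvPolynomial.C, shiftCoeff_C]
      split_ifs
      · rw [map_one, ← jacobiTrudi_of_isEmpty γ]
        exact Submodule.subset_span ⟨⟨0, γ⟩, rfl⟩
      · exact zero_mem _
    | succ l ih =>
      rw [jacobiTrudi_succ, shiftCoeff_one_bernstein]
      exact Submodule.sum_mem _ fun p _ => bernstein_mem_jacobiTrudiSpan _ (ih _ _)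
  | zero => simp
  | add f g _ _ hf hg => rw [map_add]; exact add_mem hf hg
  | smul a f _ hf => rw [map_smul]; exact Submodule.smul_mem _ _ hf

theorem mul_hPoly_mem_jacobiTrudiSpan (m : ℤ) {f : Fock} (hf : f ∈ jacobiTrudiSpan) :
    f * hPoly m ∈ jacobiTrudiSpan := by
  obtain ⟨N, hN⟩ := hPoly_mul_eq_sum_bernstein m f
  rw [hN]
  exact Submodule.sum_mem _ fun i _ =>
    bernstein_mem_jacobiTrudiSpan _ (shiftCoeff_one_mem_jacobiTrudiSpan _ hf)

theorem mul_X_mem_jacobiTrudiSpan (k : ℕ) {f : Fock} (hf : f ∈ jacobiTrudiSpan) :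
    f * MvPolynomial.X (Nat.toPNat' (k + 1)) ∈ jacobiTrudiSpan := by
  induction k using Nat.strong_induction_on generalizing f with
  | _ k ih =>
    have h := isExpSeries_hSeries.coeff_succ k
    rw [← Finset.add_sum_erase _ _ (Finset.HasAntidiagonal.mem_antidiagonal.2 (add_zero k) :
      (k, 0) ∈ Finset.HasAntidiagonal.antidiagonal k), isExpSeries_hSeries.coeff_zero, mul_one] at h
    have h2 : f * MvPolynomial.X (Nat.toPNat' (k + 1)) =
        ((k : ℂ) + 1) • (f * hPoly ((k + 1 : ℕ) : ℤ)) -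
        ∑ p ∈ (Finset.HasAntidiagonal.antidiagonal k).erase (k, 0),
          f * hPoly p.2 * MvPolynomial.X (Nat.toPNat' (p.1 + 1)) := by
      simp only [hPoly_natCast]
      have h3 : (MvPolynomial.C ((k : ℂ) + 1) : Fock) = (k : Fock) + 1 := by simp
      rw [MvPolynomial.smul_eq_C_mul, h3]
      have h4 : ∀ p : ℕ × ℕ,
          f * PowerSeries.coeff p.2 hSeries * MvPolynomial.X (Nat.toPNat' (p.1 + 1)) =
          f * (MvPolynomial.X (Nat.toPNat' (p.1 + 1)) * PowerSeries.coeff p.2 hSeries) :=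
        fun p => by ring
      simp only [h4, ← Finset.mul_sum]
      linear_combination -f * h
    rw [h2]
    refine sub_mem (Submodule.smul_mem _ _ (mul_hPoly_mem_jacobiTrudiSpan _ hf))
      (Submodule.sum_mem _ fun p hp => ?_)
    obtain ⟨h5, h6⟩ := Finset.mem_erase.1 hp
    have h6 := Finset.HasAntidiagonal.mem_antidiagonal.1 h6
    refine ih p.1 ?_ (mul_hPoly_mem_jacobiTrudiSpan _ hf)
    rcases Nat.lt_or_ge p.1 k with h7 | h7
    · exact h7
    · exact absurd (Prod.ext (by simp; omega) (by simp; omega)) h5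

theorem jacobiTrudiSpan_eq_top : jacobiTrudiSpan = ⊤ := by
  refine eq_top_iff.2 fun f _ => ?_
  induction f using MvPolynomial.induction_on with
  | C a =>
    rw [← mul_one (MvPolynomial.C a), ← MvPolynomial.smul_eq_C_mul,
      ← jacobiTrudi_of_isEmpty Fin.elim0]
    exact Submodule.smul_mem _ _ (Submodule.subset_span ⟨⟨0, _⟩, rfl⟩)
  | add f g hf hg => exact add_mem (hf trivial) (hg trivial)
  | mul_X f k hf =>
    have := mul_X_mem_jacobiTrudiSpan ((k : ℕ) - 1) (hf trivial)
    rwa [Nat.sub_add_cancel k.pos, PNat.coe_toPNat'] at this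

theorem span_schur_eq_top : Submodule.span ℂ (Set.range schur) = ⊤ := by
  refine eq_top_iff.2 (jacobiTrudiSpan_eq_top.symm.le.trans (Submodule.span_le.2 ?_))
  rintro _ ⟨x, rfl⟩
  exact jacobiTrudi_mem_span x.2

/-! ### Homogeneity, and the bases of Schur polynomials -/

theorem isWeightedHomogeneous_hPoly (n : ℕ) :
    MvPolynomial.IsWeightedHomogeneous (fun k : ℕ+ => (k : ℕ)) (hPoly n) n := by
  rw [hPoly_natCast]
  induction n using Nat.strong_induction_on with
  | _ n ih =>
    cases n with
    | zero =>
      rw [isExpSeries_hSeries.coeff_zero]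
      exact MvPolynomial.isWeightedHomogeneous_one _ _
    | succ n =>
      have h := isExpSeries_hSeries.coeff_succ n
      have hn : ((n : ℂ) + 1) ≠ 0 := by exact_mod_cast n.succ_ne_zero
      have h3 : (MvPolynomial.C ((n : ℂ) + 1) : Fock) = (n : Fock) + 1 := by simp
      have h4 : PowerSeries.coeff (n + 1) hSeries = MvPolynomial.C ((n : ℂ) + 1)⁻¹ *
          ∑ p ∈ Finset.HasAntidiagonal.antidiagonal n,
            MvPolynomial.X (Nat.toPNat' (p.1 + 1)) * PowerSeries.coeff p.2 hSeries := by
        rw [← h, ← h3, mul_left_comm, ← map_mul, inv_mul_cancel₀ hn, map_one, mul_one]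
      rw [h4]
      refine MvPolynomial.IsWeightedHomogeneous.C_mul
        (MvPolynomial.IsWeightedHomogeneous.sum _ _ _ fun p hp => ?_) _
      have hp := Finset.HasAntidiagonal.mem_antidiagonal.1 hp
      have h5 := (MvPolynomial.isWeightedHomogeneous_X ℂ (fun k : ℕ+ => (k : ℕ))
        (Nat.toPNat' (p.1 + 1))).mul (ih p.2 (by omega))
      have h6 : ((Nat.toPNat' (p.1 + 1) : ℕ+) : ℕ) + p.2 = n + 1 := by simp; omega
      rwa [h6] at h5

theorem isWeightedHomogeneous_jacobiTrudi {l : ℕ} (α : Fin l → ℕ) :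
    MvPolynomial.IsWeightedHomogeneous (fun k : ℕ+ => (k : ℕ))
      (jacobiTrudi fun i => (α i : ℤ) - (i : ℕ)) (∑ i, α i) := by
  rw [jacobiTrudi, Matrix.det_apply]
  refine MvPolynomial.IsWeightedHomogeneous.sum _ _ _ fun σ _ => ?_
  have key : MvPolynomial.IsWeightedHomogeneous (fun k : ℕ+ => (k : ℕ))
      (∏ i, hPoly ((α (σ i) : ℤ) - (σ i : ℕ) + (i : ℕ))) (∑ i, α i) := by
    by_cases h : ∀ i, 0 ≤ (α (σ i) : ℤ) - (σ i : ℕ) + (i : ℕ)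
    · have h1 : ∑ i, ((α (σ i) : ℤ) - (σ i : ℕ) + (i : ℕ)).toNat = ∑ i, α i := by
        zify
        simp only [Int.toNat_of_nonneg (h _), Finset.sum_add_distrib, Finset.sum_sub_distrib]
        rw [Equiv.sum_comp σ fun i => (α i : ℤ), Equiv.sum_comp σ fun i => ((i : ℕ) : ℤ)]
        ring
      rw [← h1]
      refine MvPolynomial.IsWeightedHomogeneous.prod _ _ _ fun i _ => ?_
      have := isWeightedHomogeneous_hPoly ((α (σ i) : ℤ) - (σ i : ℕ) + (i : ℕ)).toNat
      rwa [Int.toNat_of_nonneg (h i)] at this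
    · push Not at h
      obtain ⟨i, hi⟩ := h
      rw [Finset.prod_eq_zero (Finset.mem_univ i) (hPoly_of_neg hi)]
      exact MvPolynomial.isWeightedHomogeneous_zero _ _ _
  rcases Int.units_eq_one_or (Equiv.Perm.sign σ) with h | h
  · rw [h, one_smul]; exact key
  · rw [h, Units.neg_smul, one_smul]
    simpa using key.C_mul (-1)

theorem card_eq_sum_rowLen (lam : YoungDiagram) :
    lam.card = ∑ i ∈ Finset.range (lam.colLen 0), lam.rowLen i := by
  rw [YoungDiagram.card, Finset.card_eq_sum_card_fiberwise (f := Prod.fst)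
    (t := Finset.range (lam.colLen 0))]
  · refine Finset.sum_congr rfl fun i _ => ?_
    rw [YoungDiagram.rowLen_eq_card]
    rfl
  · rintro ⟨i, j⟩ h
    have : (i, 0) ∈ lam := lam.up_left_mem le_rfl (Nat.zero_le j) h
    exact Finset.mem_coe.2 (Finset.mem_range.2 (YoungDiagram.mem_iff_lt_colLen.1 this))

theorem isWeightedHomogeneous_schur (lam : YoungDiagram) :
    MvPolynomial.IsWeightedHomogeneous (fun k : ℕ+ => (k : ℕ)) (schur lam) lam.card := by
  rw [card_eq_sum_rowLen, Finset.sum_range fun i => lam.rowLen i]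
  exact isWeightedHomogeneous_jacobiTrudi fun i : Fin (lam.colLen 0) => lam.rowLen i

theorem weightedHomogeneousComponent_schur (n : ℕ) (lam : YoungDiagram) :
    MvPolynomial.weightedHomogeneousComponent (fun k : ℕ+ => (k : ℕ)) n (schur lam) =
      if n = lam.card then schur lam else 0 :=
  MvPolynomial.weightedHomogeneousComponent_of_mem
    ((MvPolynomial.mem_weightedHomogeneousSubmodule _ _ _ _).2 (isWeightedHomogeneous_schur lam))

theorem span_schur_card_eq (n : ℕ) :
    Submodule.span ℂ
        (Set.range fun lam : {lam : YoungDiagram // lam.card = n} => schur lam.1) =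
      MvPolynomial.weightedHomogeneousSubmodule ℂ (fun k : ℕ+ => (k : ℕ)) n := by
  refine le_antisymm (Submodule.span_le.2 ?_) fun f hf => ?_
  · rintro _ ⟨⟨lam, rfl⟩, rfl⟩
    exact (MvPolynomial.mem_weightedHomogeneousSubmodule _ _ _ _).2
      (isWeightedHomogeneous_schur lam)
  · rw [← MvPolynomial.weightedHomogeneousComponent_eq_self
      ((MvPolynomial.mem_weightedHomogeneousSubmodule _ _ _ _).1 hf)]
    have hf : f ∈ Submodule.span ℂ (Set.range schur) := span_schur_eq_top ▸ Submodule.mem_top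
    have h := Submodule.mem_map_of_mem
      (f := MvPolynomial.weightedHomogeneousComponent (R := ℂ) (fun k : ℕ+ => (k : ℕ)) n) hf
    refine (Submodule.map_span_le _ _ _).2 ?_ h
    rintro _ ⟨lam, rfl⟩
    rw [weightedHomogeneousComponent_schur]
    split_ifs with hn
    · exact Submodule.subset_span ⟨⟨lam, hn.symm⟩, rfl⟩
    · exact zero_mem _

/-- The exponent of `∏_i q_{λ_i}`. -/
def cycleType (lam : YoungDiagram) : ℕ+ →₀ ℕ :=
  Multiset.toFinsupp ((lam.rowLens : Multiset ℕ).map Nat.toPNat')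

theorem wt_toFinsupp (s : Multiset ℕ+) :
    wt (Multiset.toFinsupp s) = (s.map fun k : ℕ+ => (k : ℕ)).sum := by
  induction s using Multiset.induction with
  | empty => simp
  | cons a s ih =>
    rw [← Multiset.singleton_add, map_add, map_add, ih, Multiset.toFinsupp_singleton, wt_single]
    simp

theorem map_coe_map_toPNat' (lam : YoungDiagram) :
    ((lam.rowLens : Multiset ℕ).map Nat.toPNat').map (fun k : ℕ+ => (k : ℕ)) = lam.rowLens := by
  rw [Multiset.map_map]
  conv_rhs => rw [← Multiset.map_id (lam.rowLens : Multiset ℕ)]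
  refine Multiset.map_congr rfl fun x hx => ?_
  have hx := lam.pos_of_mem_rowLens x (by simpa using hx)
  simp [Nat.toPNat'_coe, hx]

theorem wt_cycleType (lam : YoungDiagram) : wt (cycleType lam) = lam.card := by
  rw [cycleType, wt_toFinsupp, map_coe_map_toPNat', card_eq_sum_rowLen, Multiset.sum_coe,
    YoungDiagram.rowLens]
  rfl

theorem cycleType_injective : Function.Injective cycleType := by
  intro lam mu h
  have h1 := congrArg (Multiset.map fun k : ℕ+ => (k : ℕ)) (Multiset.toFinsupp.injective h)
  rw [map_coe_map_toPNat', map_coe_map_toPNat', Multiset.coe_eq_coe] at h1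
  exact YoungDiagram.equivListRowLens.injective (Subtype.ext
    (h1.eq_of_sortedGE lam.rowLens_sorted mu.rowLens_sorted))

/-- The Schur polynomials of degree `n` span, and there are at most as many of them as monomials. -/
theorem linearIndependent_schur_card_eq (n : ℕ) :
    LinearIndependent ℂ fun lam : {lam : YoungDiagram // lam.card = n} => schur lam.1 := by
  have hmem : ∀ lam : {lam : YoungDiagram // lam.card = n}, cycleType lam.1 ∈ exponents n :=
    fun lam => by rw [mem_exponents, wt_cycleType, lam.2]
  have hinj : Function.Injective fun lam : {lam : YoungDiagram // lam.card = n} =>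
      (⟨cycleType lam.1, hmem lam⟩ : exponents n) := fun lam mu h =>
    Subtype.ext (cycleType_injective (Subtype.ext_iff.1 h))
  have : Fintype {lam : YoungDiagram // lam.card = n} := Fintype.ofInjective _ hinj
  rw [linearIndependent_iff_card_le_finrank_span]
  refine (Fintype.card_le_of_injective _ hinj).trans ?_
  rw [Set.finrank, span_schur_card_eq]
  have : Module.Finite ℂ
      (MvPolynomial.weightedHomogeneousSubmodule ℂ (fun k : ℕ+ => (k : ℕ)) n) := by
    rw [← span_schur_card_eq]
    exact Module.Finite.span_of_finite ℂ (Set.finite_range _)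
  have hli : LinearIndependent ℂ fun μ : exponents n =>
      (⟨MvPolynomial.monomial μ.1 1, (MvPolynomial.mem_weightedHomogeneousSubmodule _ _ _ _).2
        (MvPolynomial.isWeightedHomogeneous_monomial _ _ _ (mem_exponents.1 μ.2))⟩ :
        MvPolynomial.weightedHomogeneousSubmodule ℂ (fun k : ℕ+ => (k : ℕ)) n) := by
    refine LinearIndependent.of_comp (Submodule.subtype _) ?_
    have := (MvPolynomial.basisMonomials ℕ+ ℂ).linearIndependent.comp
      (fun μ : exponents n => μ.1) Subtype.val_injective
    simpa [Function.comp_def] using this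
  exact hli.fintype_card_le_finrank

theorem linearIndependent_schur : LinearIndependent ℂ schur := by
  rw [linearIndependent_iff']
  intro s g hg lam hlam
  have h1 := congrArg
    (MvPolynomial.weightedHomogeneousComponent (fun k : ℕ+ => (k : ℕ)) lam.card) hg
  simp only [map_sum, map_smul, weightedHomogeneousComponent_schur, map_zero, smul_ite,
    smul_zero] at h1
  rw [← Finset.sum_filter] at h1
  have h2 : LinearIndepOn ℂ schur {mu | mu.card = lam.card} :=
    linearIndependent_schur_card_eq lam.card
  refine linearIndepOn_iff'.1 h2 _ g ?_ h1 lam (Finset.mem_filter.2 ⟨hlam, rfl⟩)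
  intro mu hmu
  exact (Finset.mem_filter.1 (Finset.mem_coe.1 hmu)).2.symm

/-- The basis of Schur polynomials. -/
def schurBasis : Module.Basis YoungDiagram ℂ Fock :=
  Module.Basis.mk linearIndependent_schur span_schur_eq_top.ge

/-! ### The coefficients of the symbol -/

/-- The coefficient `∏_v a_v ^ d_v / d_v!` of the exponential of a linear form. -/
def expMonomial {σ : Type} (a : σ → ℂ) (d : σ →₀ ℕ) : ℂ :=
  d.prod fun v j => a v ^ j / (j.factorial : ℂ)

theorem expMonomial_sub_single {σ : Type} (a : σ → ℂ) (d : σ →₀ ℕ) {v : σ} (hv : v ∈ d.support) :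
    a v * expMonomial a (d - Finsupp.single v 1) = d v * expMonomial a d := by
  classical
  have hs : ∀ e : σ →₀ ℕ, e.support ⊆ d.support → expMonomial a e =
      (a v ^ e v / ((e v).factorial : ℂ)) *
        ∏ i ∈ d.support.erase v, a i ^ e i / ((e i).factorial : ℂ) := by
    intro e he
    rw [expMonomial, Finsupp.prod_of_support_subset _ he _ (fun i _ => by simp),
      Finset.mul_prod_erase _ (fun i => a i ^ e i / ((e i).factorial : ℂ)) hv]
  rw [hs d subset_rfl, hs (d - Finsupp.single v 1) Finsupp.support_tsub]
  have h1 : ∀ i ∈ d.support.erase v, (d - Finsupp.single v 1 : σ →₀ ℕ) i = d i := by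
    intro i hi
    simp [(Finset.ne_of_mem_erase hi).symm]
  rw [Finset.prod_congr rfl fun i hi => by rw [h1 i hi], ← mul_assoc, ← mul_assoc]
  congr 1
  obtain ⟨j, hj⟩ := Nat.exists_eq_succ_of_ne_zero (Finsupp.mem_support_iff.1 hv)
  have h2 : (d - Finsupp.single v 1 : σ →₀ ℕ) v = j := by simp [hj]
  have h3 : ((j : ℂ) + 1) ≠ 0 := by exact_mod_cast j.succ_ne_zero
  have h4 : (j.factorial : ℂ) ≠ 0 := by exact_mod_cast j.factorial_ne_zero
  rw [h2, hj, Nat.succ_eq_add_one, Nat.factorial_succ]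
  push_cast
  field_simp
  ring

theorem coeff_linearForm_mul {σ : Type} (a : σ → ℂ) (G : MvPowerSeries σ ℂ) (d : σ →₀ ℕ) :
    MvPowerSeries.coeff d (linearForm a * G) =
      ∑ v ∈ d.support, a v * MvPowerSeries.coeff (d - Finsupp.single v 1) G := by
  classical
  rw [MvPowerSeries.coeff_mul]
  refine (Finset.sum_of_injOn (fun v => (Finsupp.single v 1, d - Finsupp.single v 1))
    ?_ ?_ ?_ ?_).symm
  · intro v _ w _ h
    exact Finsupp.single_left_injective one_ne_zero (Prod.ext_iff.1 h).1
  · intro v hv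
    have : Finsupp.single v 1 ≤ d := by
      simpa [Nat.one_le_iff_ne_zero] using hv
    exact Finset.mem_coe.2 (Finset.HasAntidiagonal.mem_antidiagonal.2 (add_tsub_cancel_of_le this))
  · rintro ⟨p, q⟩ hp hne
    have hp := Finset.HasAntidiagonal.mem_antidiagonal.1 hp
    simp only at hp ⊢
    rw [show MvPowerSeries.coeff p (linearForm a) = linearForm a p from rfl, linearForm, if_neg,
      zero_mul]
    intro hdeg
    obtain ⟨v, rfl⟩ : ∃ v, Finsupp.single v 1 = p := by
      have : p ∈ {d : σ →₀ ℕ | d.degree = 1} := hdeg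
      rwa [← Finsupp.range_single_one] at this
    refine hne ⟨v, ?_, ?_⟩
    · rw [← hp]; simp
    · rw [← hp]; simp
  · intro v _
    rw [show MvPowerSeries.coeff (Finsupp.single v 1) (linearForm a) =
      linearForm a (Finsupp.single v 1) from rfl, linearForm, if_pos (by simp)]
    simp

theorem coeff_linearForm_pow {σ : Type} (a : σ → ℂ) (k : ℕ) (d : σ →₀ ℕ) :
    MvPowerSeries.coeff d (linearForm a ^ k) =
      if d.degree = k then (k.factorial : ℂ) * expMonomial a d else 0 := by
  classical
  induction k generalizing d with
  | zero =>
    rw [pow_zero, MvPowerSeries.coeff_one]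
    simp only [Finsupp.degree_eq_zero_iff]
    split_ifs with h
    · simp [h, expMonomial]
    · rfl
  | succ k ih =>
    rw [pow_succ', coeff_linearForm_mul]
    simp only [ih]
    have hdeg : ∀ v ∈ d.support, (d - Finsupp.single v 1).degree + 1 = d.degree := by
      intro v hv
      have : Finsupp.single v 1 ≤ d := by simpa [Nat.one_le_iff_ne_zero] using hv
      conv_rhs => rw [← tsub_add_cancel_of_le this]
      rw [map_add]; simp
    split_ifs with h
    · have h1 : ∀ v ∈ d.support, a v * (if (d - Finsupp.single v 1).degree = k then
          (k.factorial : ℂ) * expMonomial a (d - Finsupp.single v 1) else 0) =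
          (d v : ℂ) * ((k.factorial : ℂ) * expMonomial a d) := by
        intro v hv
        have := hdeg v hv
        rw [if_pos (by omega), mul_left_comm, expMonomial_sub_single a d hv]
        ring
      rw [Finset.sum_congr rfl h1, ← Finset.sum_mul, ← Nat.cast_sum, ← Finsupp.degree_apply, h,
        Nat.factorial_succ]
      push_cast
      ring
    · refine Finset.sum_eq_zero fun v hv => ?_
      have := hdeg v hv
      rw [if_neg (by omega), mul_zero]

theorem coeff_expSeries (c : ℂ) {σ : Type} (a : σ → ℂ) (d : σ →₀ ℕ) :
    MvPowerSeries.coeff d (expSeries (MvPowerSeries.C c + linearForm a)) =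
      Complex.exp c * expMonomial a d := by
  have h1 : ∀ N : ℕ, MvPowerSeries.coeff d ((MvPowerSeries.C c + linearForm a) ^ N) /
      (N.factorial : ℂ) = if d.degree ≤ N then
        c ^ (N - d.degree) / ((N - d.degree).factorial : ℂ) * expMonomial a d else 0 := by
    intro N
    have h2 : ∀ m, MvPowerSeries.coeff d (MvPowerSeries.C c ^ m * linearForm a ^ (N - m) *
        (N.choose m : MvPowerSeries σ ℂ)) =
        c ^ m * (if d.degree = N - m then ((N - m).factorial : ℂ) * expMonomial a d else 0) *
          (N.choose m : ℂ) := by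
      intro m
      rw [← map_pow, ← map_natCast (MvPowerSeries.C : ℂ →+* MvPowerSeries σ ℂ), mul_comm,
        MvPowerSeries.coeff_C_mul, MvPowerSeries.coeff_C_mul, coeff_linearForm_pow]
      ring
    rw [add_pow, map_sum]
    simp only [h2]
    split_ifs with h
    · rw [Finset.sum_eq_single (N - d.degree)]
      · have h3 : N - (N - d.degree) = d.degree := by omega
        rw [h3, if_pos rfl]
        have h4 : ((N - d.degree).factorial : ℂ) ≠ 0 := by exact_mod_cast Nat.factorial_ne_zero _
        have h5 : (N.factorial : ℂ) ≠ 0 := by exact_mod_cast Nat.factorial_ne_zero _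
        have h6 : (d.degree.factorial : ℂ) * (N.choose (N - d.degree) : ℂ) *
            ((N - d.degree).factorial : ℂ) = (N.factorial : ℂ) := by
          rw [Nat.choose_symm h]
          exact_mod_cast (by
            rw [mul_comm (d.degree.factorial)]; exact Nat.choose_mul_factorial_mul_factorial h)
        rw [div_mul_eq_mul_div, div_eq_div_iff h5 h4, ← h6]
        ring
      · intro m hm hne
        have hm := Finset.mem_range.1 hm
        rw [if_neg (by omega), mul_zero, zero_mul]
      · intro hm
        exact absurd (Finset.mem_range.2 (by omega)) hm
    · rw [Finset.sum_eq_zero, zero_div]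
      intro m _
      rw [if_neg (by omega), mul_zero, zero_mul]
  have h2 : HasSum (fun n : ℕ => c ^ n / (n.factorial : ℂ) * expMonomial a d)
      (Complex.exp c * expMonomial a d) := by
    rw [Complex.exp_eq_exp_ℂ]
    exact (NormedSpace.expSeries_div_hasSum_exp c).mul_right _
  have h3 : HasSum (fun N : ℕ => if d.degree ≤ N then
        c ^ (N - d.degree) / ((N - d.degree).factorial : ℂ) * expMonomial a d else 0)
      (Complex.exp c * expMonomial a d) := by
    refine (Function.Injective.hasSum_iff (add_left_injective d.degree) ?_).1 ?_
    · intro N hN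
      rw [if_neg]
      intro h
      exact hN ⟨N - d.degree, Nat.sub_add_cancel h⟩
    · simpa [Function.comp_def] using h2
  change ∑' N : ℕ, MvPowerSeries.coeff d ((MvPowerSeries.C c + linearForm a) ^ N) /
      (N.factorial : ℂ) = _
  simp only [h1]
  exact h3.tsum_eq

theorem smul_linearForm {σ : Type} (z : ℂ) (a : σ → ℂ) :
    z • linearForm a = linearForm fun v => z * a v := by
  ext d
  rw [MvPowerSeries.coeff_smul]
  change z * linearForm a d = linearForm (fun v => z * a v) d
  simp only [linearForm, mul_ite, mul_zero, Finset.mul_sum]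

/-- The total Fourier mode of a monomial in the `q_k, p_k`. -/
def totalFreq (d : Var →₀ ℕ) : ℤ := d.sum fun v j => (j : ℤ) * freq v

/-- The positive number `k` of a variable `q_k` or `p_k`. -/
def varIndex : Var → ℕ+ := Sum.elim id id

/-- The number `z s(ħ^{1/2} z k)`. -/
def amplitude (z ħ : ℂ) (k : ℕ+) : ℂ := z * sFun (sqrtH ħ * z * (k : ℕ))

theorem sFun_neg (t : ℂ) : sFun (-t) = sFun t := by
  simp [sFun, neg_div, Complex.sinh_neg, div_neg]

theorem sFun_freq (ħ z : ℂ) (v : Var) :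
    z * sFun (Complex.I * sqrtH ħ * z * (Complex.I * (freq v : ℂ))) =
      amplitude z ħ (varIndex v) := by
  have h : ∀ x : ℂ, Complex.I * sqrtH ħ * z * (Complex.I * x) = -(sqrtH ħ * z * x) := fun x => by
    linear_combination sqrtH ħ * z * x * Complex.I_mul_I
  rw [h, sFun_neg]
  cases v with
  | inl k => simp [freq, amplitude, varIndex]
  | inr k =>
    simp only [freq, amplitude, varIndex, Sum.elim_inr, id]
    push_cast
    rw [mul_neg, sFun_neg]

theorem integral_exp_int (n : ℤ) :
    ∫ x in (0 : ℝ)..(2 * Real.pi), Complex.exp (Complex.I * n * (x : ℂ)) =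
      if n = 0 then 2 * (Real.pi : ℂ) else 0 := by
  split_ifs with h
  · simp [h]
  · have hn : Complex.I * (n : ℂ) ≠ 0 := mul_ne_zero Complex.I_ne_zero (by exact_mod_cast h)
    have h1 : Complex.exp (Complex.I * n * ((2 * Real.pi : ℝ) : ℂ)) = 1 := by
      rw [Complex.exp_eq_one_iff]
      exact ⟨n, by push_cast; ring⟩
    rw [integral_exp_mul_complex hn, h1]
    simp

theorem coeff_expSeries_smoothedField (z u₀ ħ : ℂ) (x : ℝ) (d : Var →₀ ℕ) :
    MvPowerSeries.coeff d (expSeries (z • smoothedField (Complex.I * sqrtH ħ * z) u₀ x)) =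
      Complex.exp (z * u₀) * expMonomial (fun v => amplitude z ħ (varIndex v)) d *
        Complex.exp (Complex.I * totalFreq d * (x : ℂ)) := by
  have h0 : sFun 0 = 1 := by simp [sFun]
  rw [smoothedField, smul_add, smul_linearForm, MvPowerSeries.smul_eq_C_mul, ← map_mul, h0, one_mul,
    coeff_expSeries]
  have h1 : (fun v => z * (sFun (Complex.I * sqrtH ħ * z * (Complex.I * (freq v : ℂ))) *
      Complex.exp (Complex.I * (freq v : ℂ) * (x : ℂ)))) =
      fun v => amplitude z ħ (varIndex v) * Complex.exp (Complex.I * (freq v : ℂ) * (x : ℂ)) := by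
    funext v
    rw [← mul_assoc, sFun_freq]
  rw [h1, mul_assoc]
  congr 1
  rw [expMonomial, expMonomial, totalFreq, Finsupp.sum, Int.cast_sum, Finset.mul_sum,
    Finset.sum_mul, Complex.exp_sum, Finsupp.prod, Finsupp.prod, ← Finset.prod_mul_distrib]
  refine Finset.prod_congr rfl fun v _ => ?_
  rw [mul_pow, ← Complex.exp_nat_mul, mul_div_right_comm]
  congr 2
  push_cast
  ring

theorem coeff_symbol (z u₀ ħ : ℂ) (d : Var →₀ ℕ) :
    MvPowerSeries.coeff d (symbol z u₀ ħ) = if totalFreq d = 0 then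
      Complex.exp (z * u₀) / sFun (sqrtH ħ * z) *
        expMonomial (fun v => amplitude z ħ (varIndex v)) d else 0 := by
  change (2 * (Real.pi : ℂ) * sFun (sqrtH ħ * z))⁻¹ * ∫ x in (0 : ℝ)..(2 * Real.pi),
    MvPowerSeries.coeff d (expSeries (z • smoothedField (Complex.I * sqrtH ħ * z) u₀ x)) = _
  simp only [coeff_expSeries_smoothedField]
  rw [intervalIntegral.integral_const_mul, integral_exp_int]
  split_ifs
  · have : (Real.pi : ℂ) ≠ 0 := by exact_mod_cast Real.pi_ne_zero
    rw [mul_inv, div_eq_mul_inv]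
    field_simp
  · simp

/-! ### Normal ordering -/

theorem pHat_pow_monomial (ħ : ℂ) (k : ℕ+) (j : ℕ) (m : ℕ+ →₀ ℕ) :
    (pHat ħ k ^ j) (MvPolynomial.monomial m 1) =
      ((ħ * (k : ℕ)) ^ j * ((m k).descFactorial j : ℂ)) •
        MvPolynomial.monomial (m - Finsupp.single k j) (1 : ℂ) := by
  induction j with
  | zero => simp
  | succ j ih =>
    rw [pow_succ', Module.End.mul_apply, ih, map_smul, pHat, LinearMap.smul_apply,
      Derivation.coeFn_coe, MvPolynomial.pderiv_monomial, one_mul]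
    have h1 : m - Finsupp.single k j - Finsupp.single k 1 = m - Finsupp.single k (j + 1) := by
      rw [tsub_tsub, ← Finsupp.single_add]
    have h2 : (m - Finsupp.single k j : ℕ+ →₀ ℕ) k = m k - j := by simp
    have h3 : ∀ e : ℕ+ →₀ ℕ, MvPolynomial.monomial e ((m k - j : ℕ) : ℂ) =
        ((m k - j : ℕ) : ℂ) • MvPolynomial.monomial e (1 : ℂ) := fun e => by
      rw [MvPolynomial.smul_monomial, smul_eq_mul, mul_one]
    rw [h1, h2, h3, smul_smul, smul_smul, Nat.descFactorial_succ]
    congr 1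
    push_cast
    ring

theorem noncommProd_pHat_monomial (ħ : ℂ) (g : ℕ+ → ℕ) (m : ℕ+ →₀ ℕ) (s : Finset ℕ+)
    (comm : (s : Set ℕ+).Pairwise (Function.onFun Commute fun k => pHat ħ k ^ g k)) :
    s.noncommProd (fun k => pHat ħ k ^ g k) comm (MvPolynomial.monomial m 1) =
      (∏ k ∈ s, ((ħ * (k : ℕ)) ^ g k * ((m k).descFactorial (g k) : ℂ))) •
        MvPolynomial.monomial (m - ∑ k ∈ s, Finsupp.single k (g k)) (1 : ℂ) := by
  classical
  induction s using Finset.induction_on with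
  | empty => simp
  | insert a s ha ih =>
    have h1 : (m - ∑ k ∈ s, Finsupp.single k (g k) : ℕ+ →₀ ℕ) a = m a := by
      rw [Finsupp.tsub_apply, Finsupp.finsetSum_apply, Finset.sum_eq_zero, Nat.sub_zero]
      intro k hk
      exact Finsupp.single_eq_of_ne (by rintro rfl; exact ha hk)
    rw [Finset.noncommProd_insert_of_notMem _ _ _ _ ha, Module.End.mul_apply, ih, map_smul,
      pHat_pow_monomial, h1, smul_smul, Finset.prod_insert ha, Finset.sum_insert ha, tsub_tsub]
    congr 1
    · ring
    · rw [add_comm]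

/-- The coefficient of `q^{m-ν}` in `∏_k p̂_k^{ν_k} q^m`. -/
def lowerCoeff (ħ : ℂ) (m ν : ℕ+ →₀ ℕ) : ℂ :=
  ν.prod fun k j => (ħ * (k : ℕ)) ^ j * ((m k).descFactorial j : ℂ)

theorem pMonomial_monomial (ħ : ℂ) (m ν : ℕ+ →₀ ℕ) :
    pMonomial ħ ν (MvPolynomial.monomial m 1) =
      lowerCoeff ħ m ν • MvPolynomial.monomial (m - ν) (1 : ℂ) := by
  have h : ∑ k ∈ ν.support, Finsupp.single k (ν k) = ν := Finsupp.sum_single ν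
  rw [pMonomial, noncommProd_pHat_monomial, h]
  rfl

theorem lowerCoeff_eq_zero (ħ : ℂ) {m ν : ℕ+ →₀ ℕ} (h : ¬ν ≤ m) : lowerCoeff ħ m ν = 0 := by
  rw [Finsupp.le_def] at h
  push Not at h
  obtain ⟨k, hk⟩ := h
  refine Finset.prod_eq_zero (Finsupp.mem_support_iff.2 (by omega) : k ∈ ν.support) ?_
  beta_reduce
  rw [Nat.descFactorial_eq_zero_iff_lt.2 hk, Nat.cast_zero, mul_zero]

theorem qMonomial_apply (μ : ℕ+ →₀ ℕ) (f : Fock) :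
    qMonomial μ f = MvPolynomial.monomial μ 1 * f := by
  rw [qMonomial, LinearMap.mulLeft_apply, MvPolynomial.monomial_eq, map_one, one_mul]
  rfl

theorem normalMonomial_sumElim (ħ : ℂ) (m μ ν : ℕ+ →₀ ℕ) :
    normalMonomial ħ (μ.sumElim ν) (MvPolynomial.monomial m 1) =
      lowerCoeff ħ m ν • (MvPolynomial.monomial μ 1 * MvPolynomial.monomial (m - ν) 1) := by
  rw [normalMonomial, Finsupp.comapDomain_inl_sumElim, Finsupp.comapDomain_inr_sumElim,
    Module.End.mul_apply, pMonomial_monomial, qMonomial_apply, mul_smul_comm]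

theorem totalFreq_sumElim (μ ν : ℕ+ →₀ ℕ) : totalFreq (μ.sumElim ν) = (wt μ : ℤ) - wt ν := by
  have : totalFreq (μ.sumElim ν) = μ.sum (fun k j => (j : ℤ) * ((k : ℕ) : ℤ)) +
      ν.sum (fun k j => (j : ℤ) * -((k : ℕ) : ℤ)) := by
    rw [totalFreq, Finsupp.sum_sumElim]
    rfl
  rw [this, wt_eq_sum, wt_eq_sum, Finsupp.sum, Finsupp.sum]
  push_cast
  simp only [mul_neg, Finset.sum_neg_distrib, sub_eq_add_neg]

/-- If only monomials of total Fourier mode zero occur in `F`, normal ordering is a finite sum on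
each monomial. -/
theorem normalOrder_monomial (ħ : ℂ) {F : MvPowerSeries Var ℂ}
    (hF : ∀ d, totalFreq d ≠ 0 → MvPowerSeries.coeff d F = 0) (m : ℕ+ →₀ ℕ) :
    normalOrder ħ F (MvPolynomial.monomial m 1) = ∑ ν ∈ Finset.Iic m, ∑ μ ∈ exponents (wt ν),
      MvPowerSeries.coeff (μ.sumElim ν) F •
        normalMonomial ħ (μ.sumElim ν) (MvPolynomial.monomial m 1) := by
  classical
  have h1 : normalOrder ħ F (MvPolynomial.monomial m 1) = ∑ᶠ d : Var →₀ ℕ,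
      MvPowerSeries.coeff d F • normalMonomial ħ d (MvPolynomial.monomial m 1) :=
    (MvPolynomial.basisMonomials ℕ+ ℂ).constr_basis ℂ _ m
  have hinj : Function.Injective fun x : Σ _ : ℕ+ →₀ ℕ, ℕ+ →₀ ℕ => x.2.sumElim x.1 := by
    rintro ⟨ν, μ⟩ ⟨ν', μ'⟩ h
    simp only at h
    have h2 := congrArg (fun d => d.comapDomain Sum.inl Sum.inl_injective.injOn) h
    have h3 := congrArg (fun d => d.comapDomain Sum.inr Sum.inr_injective.injOn) h
    simp only [Finsupp.comapDomain_inl_sumElim, Finsupp.comapDomain_inr_sumElim] at h2 h3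
    rw [h2, h3]
  rw [h1, finsum_eq_sum_of_support_subset _
    (s := ((Finset.Iic m).sigma fun ν => exponents (wt ν)).map ⟨_, hinj⟩), Finset.sum_map,
    Finset.sum_sigma]
  · rfl
  · intro d hd
    rw [Function.mem_support] at hd
    obtain ⟨μ, ν, rfl⟩ : ∃ μ ν : ℕ+ →₀ ℕ, μ.sumElim ν = d :=
      ⟨_, _, Finsupp.comapDomain_sumElim_comapDomain d⟩
    rw [normalMonomial_sumElim] at hd
    refine Finset.mem_coe.2 (Finset.mem_map.2 ⟨⟨ν, μ⟩, ?_, rfl⟩)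
    rw [Finset.mem_sigma, Finset.mem_Iic, mem_exponents]
    constructor
    · by_contra h
      exact hd (by rw [lowerCoeff_eq_zero ħ h, zero_smul, smul_zero])
    · by_contra h
      refine hd ?_
      rw [hF, zero_smul]
      rw [totalFreq_sumElim]
      simp only at h
      omega

theorem finsupp_range_eq_Iic (m : ℕ+ →₀ ℕ) :
    m.support.finsupp (fun k => Finset.range (m k + 1)) = Finset.Iic m := by
  ext ν
  rw [Finset.mem_finsupp_iff, Finset.mem_Iic]
  constructor
  · rintro ⟨h1, h2⟩ k
    by_cases hk : k ∈ m.support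
    · have := Finset.mem_range.1 (h2 k hk); omega
    · have : ν k = 0 := by
        by_contra h
        exact hk (h1 (Finsupp.mem_support_iff.2 h))
      omega
  · intro h
    refine ⟨Finsupp.support_mono h, fun k _ => Finset.mem_range.2 ?_⟩
    have := h k
    omega

theorem prod_sum_range_eq_sum_Iic {R : Type*} [CommSemiring R] (m : ℕ+ →₀ ℕ) (f : ℕ+ → ℕ → R) :
    ∏ k ∈ m.support, ∑ j ∈ Finset.range (m k + 1), f k j =
      ∑ ν ∈ Finset.Iic m, ∏ k ∈ m.support, f k (ν k) := by
  classical
  rw [Finset.prod_sum, ← finsupp_range_eq_Iic, Finset.finsupp, Finset.sum_map]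
  refine Finset.sum_congr (by congr!) fun p hp => ?_
  rw [← Finset.prod_attach m.support]
  refine Finset.prod_congr rfl fun x _ => ?_
  rw [Function.Embedding.coeFn_mk, Finsupp.indicator_of_mem x.2]

/-- The binomial formula for the shift of a monomial. -/
theorem shift_monomial (τ : ℕ+ → ℂ) (m : ℕ+ →₀ ℕ) :
    shift τ (MvPolynomial.monomial m 1) = ∑ ν ∈ Finset.Iic m, Polynomial.monomial (wt ν)
      (MvPolynomial.C (ν.prod fun k j => τ k ^ j * ((m k).choose j : ℂ)) *
        MvPolynomial.monomial (m - ν) 1) := by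
  have h1 : ∀ k, shift τ (MvPolynomial.X k) ^ m k = ∑ j ∈ Finset.range (m k + 1),
      Polynomial.C (MvPolynomial.C (τ k ^ j * ((m k).choose j : ℂ)) *
        MvPolynomial.X k ^ (m k - j)) * Polynomial.X ^ (j * (k : ℕ)) := by
    intro k
    rw [shift_X, add_comm, add_pow]
    refine Finset.sum_congr rfl fun j _ => ?_
    rw [← Polynomial.C_mul_X_pow_eq_monomial, mul_pow, ← pow_mul, mul_comm (k : ℕ)]
    simp only [map_mul, map_pow, map_natCast]
    ring
  have h2 : shift τ (MvPolynomial.monomial m 1) =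
      ∏ k ∈ m.support, shift τ (MvPolynomial.X k) ^ m k := by
    rw [MvPolynomial.monomial_eq, map_one, one_mul, Finsupp.prod, map_prod]
    simp only [map_pow]
  rw [h2, Finset.prod_congr rfl fun k _ => h1 k, prod_sum_range_eq_sum_Iic m fun k j =>
    Polynomial.C (MvPolynomial.C (τ k ^ j * ((m k).choose j : ℂ)) *
        MvPolynomial.X k ^ (m k - j)) * Polynomial.X ^ (j * (k : ℕ))]
  refine Finset.sum_congr rfl fun ν hν => ?_
  have hsupp : ν.support ⊆ m.support := Finsupp.support_mono (Finset.mem_Iic.1 hν)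
  have e1 : wt ν = ∑ k ∈ m.support, ν k * (k : ℕ) := by
    rw [wt_eq_sum]
    refine Finset.sum_subset hsupp fun k _ hk => ?_
    rw [Finsupp.notMem_support_iff.1 hk, zero_mul]
  have e2 : (MvPolynomial.monomial (m - ν) 1 : Fock) =
      ∏ k ∈ m.support, MvPolynomial.X k ^ (m k - ν k) := by
    rw [MvPolynomial.monomial_eq, map_one, one_mul, Finsupp.prod_of_support_subset _
        (Finsupp.support_tsub) _ (fun k _ => by simp)]
    rfl
  have e3 : (ν.prod fun k j => τ k ^ j * ((m k).choose j : ℂ)) =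
      ∏ k ∈ m.support, τ k ^ ν k * ((m k).choose (ν k) : ℂ) :=
    Finsupp.prod_of_support_subset _ hsupp _ (fun k _ => by simp)
  rw [Finset.prod_mul_distrib, Finset.prod_pow_eq_pow_sum, ← map_prod, Finset.prod_mul_distrib,
    ← map_prod, Polynomial.C_mul_X_pow_eq_monomial, e1, e2, e3]

theorem dividedMonomial_smul (a : ℕ+ → ℂ) (μ : ℕ+ →₀ ℕ) :
    dividedMonomial (fun k => MvPolynomial.C (a k) * MvPolynomial.X k) μ =
      expMonomial a μ • MvPolynomial.monomial μ 1 := by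
  rw [dividedMonomial, expMonomial, MvPolynomial.smul_eq_C_mul, MvPolynomial.monomial_eq, map_one,
    one_mul, Finsupp.prod, Finsupp.prod, Finsupp.prod, map_prod, ← Finset.prod_mul_distrib]
  refine Finset.prod_congr rfl fun k _ => ?_
  rw [mul_pow, ← mul_assoc, ← map_pow, ← map_mul, div_eq_inv_mul]

/-- The generating operator acts as a shift followed by a multiplication. -/
theorem genH_eq_shiftPairing (z u₀ ħ : ℂ) :
    genH z u₀ ħ = (Complex.exp (z * u₀) / sFun (sqrtH ħ * z)) •
      shiftPairing (expCoeff fun k => MvPolynomial.C (amplitude z ħ k) * MvPolynomial.X k)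
        (fun k => amplitude z ħ k * (ħ * (k : ℕ))) := by
  refine (MvPolynomial.basisMonomials ℕ+ ℂ).ext fun m => ?_
  rw [MvPolynomial.coe_basisMonomials, genH, normalOrder_monomial ħ
    (fun d hd => by rw [coeff_symbol, if_neg hd]), LinearMap.smul_apply, shiftPairing_apply,
    shift_monomial, map_sum, Finset.smul_sum]
  refine Finset.sum_congr rfl fun ν _ => ?_
  rw [pairing_monomial, expCoeff, Finset.mul_sum, Finset.smul_sum]
  refine Finset.sum_congr rfl fun μ hμ => ?_
  have h0 : totalFreq (μ.sumElim ν) = 0 := by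
    rw [totalFreq_sumElim, mem_exponents.1 hμ, sub_self]
  have h1 : expMonomial (fun v => amplitude z ħ (varIndex v)) (μ.sumElim ν) =
      expMonomial (amplitude z ħ) μ * expMonomial (amplitude z ħ) ν := by
    rw [expMonomial, Finsupp.prod_sumElim]
    rfl
  have h2 : expMonomial (amplitude z ħ) ν * lowerCoeff ħ m ν =
      ν.prod fun k j => (amplitude z ħ k * (ħ * (k : ℕ))) ^ j * ((m k).choose j : ℂ) := by
    rw [expMonomial, lowerCoeff, ← Finsupp.prod_mul]
    refine Finset.prod_congr rfl fun k _ => ?_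
    have h3 : ((ν k).factorial : ℂ) ≠ 0 := by exact_mod_cast Nat.factorial_ne_zero _
    beta_reduce
    rw [Nat.descFactorial_eq_factorial_mul_choose, mul_pow]
    push_cast
    field_simp
    ring
  rw [coeff_symbol, if_pos h0, h1, normalMonomial_sumElim, ← h2, dividedMonomial_smul]
  simp only [MvPolynomial.smul_eq_C_mul, map_mul]
  ring

/-! ### Eigenvectors of the generating operator -/

theorem sqrtH_mul_self (ħ : ℂ) : sqrtH ħ * sqrtH ħ = ħ := by
  have := Complex.cpow_nat_inv_pow ħ two_ne_zero
  rw [sqrtH, ← sq, one_div]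
  exact_mod_cast this

theorem sqrtH_ne_zero {ħ : ℂ} (hħ : ħ ≠ 0) : sqrtH ħ ≠ 0 := by
  intro h
  have := sqrtH_mul_self ħ
  rw [h, mul_zero] at this
  exact hħ this.symm

/-- The substitution `q_k ↦ a q_k`. -/
def scaleVars (a : ℂ) : Fock →ₐ[ℂ] Fock :=
  MvPolynomial.aeval fun k => MvPolynomial.C a * MvPolynomial.X k

theorem scaleVars_X (a : ℂ) (k : ℕ+) :
    scaleVars a (MvPolynomial.X k) = MvPolynomial.C a * MvPolynomial.X k := by
  simp [scaleVars]

theorem scaleVars_C (a c : ℂ) : scaleVars a (MvPolynomial.C c) = MvPolynomial.C c := by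
  rw [← MvPolynomial.algebraMap_eq, AlgHom.commutes]

theorem scaleVars_comp {a c : ℂ} (h : a * c = 1) :
    (scaleVars a).comp (scaleVars c) = AlgHom.id ℂ Fock := by
  refine MvPolynomial.algHom_ext fun k => ?_
  rw [AlgHom.comp_apply, scaleVars_X, map_mul, scaleVars_C, scaleVars_X, ← mul_assoc, ← map_mul,
    mul_comm c, h, map_one, one_mul]
  rfl

theorem schurRescaled_eq (ħ : ℂ) (lam : YoungDiagram) :
    schurRescaled ħ lam = scaleVars (sqrtH ħ)⁻¹ (schur lam) := rfl

theorem pairing_map_scaleVars (a : ℂ) (F : ℕ → Fock) (p : Polynomial Fock) :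
    pairing (fun n => scaleVars a (F n)) (p.map (scaleVars a : Fock →+* Fock)) =
      scaleVars a (pairing F p) := by
  induction p using Polynomial.induction_on' with
  | add p q hp hq => rw [Polynomial.map_add, map_add, hp, hq, map_add, map_add]
  | monomial n c => rw [Polynomial.map_monomial, pairing_monomial, pairing_monomial, map_mul]; rfl

theorem shift_scaleVars {a : ℂ} {τ τ' : ℕ+ → ℂ} (h : ∀ k, a * τ' k = τ k) (f : Fock) :
    shift τ' (scaleVars a f) = (shift τ f).map (scaleVars a : Fock →+* Fock) := by
  have key : (shift τ').comp (scaleVars a) =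
      (Polynomial.mapAlgHom (scaleVars a)).comp (shift τ) := by
    refine MvPolynomial.algHom_ext fun k => ?_
    rw [AlgHom.comp_apply, AlgHom.comp_apply, scaleVars_X, map_mul, shift_X, shift_C, shift_X,
      Polynomial.coe_mapAlgHom, Polynomial.map_add, Polynomial.map_C, Polynomial.map_monomial,
      mul_add, Polynomial.C_mul_monomial, ← map_mul, ← map_mul, h, RingHom.coe_coe, scaleVars_X,
      scaleVars_C]
  exact DFunLike.congr_fun key f

theorem shiftPairing_scaleVars {a : ℂ} {F F' : ℕ → Fock} {τ τ' : ℕ+ → ℂ}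
    (hF : ∀ n, scaleVars a (F n) = F' n) (h : ∀ k, a * τ' k = τ k) (f : Fock) :
    shiftPairing F' τ' (scaleVars a f) = scaleVars a (shiftPairing F τ f) := by
  rw [shiftPairing_apply, shiftPairing_apply, shift_scaleVars h, ← pairing_map_scaleVars]
  simp only [hF]

theorem sFun_mul_self (t : ℂ) : sFun t * t = Complex.exp (t / 2) - Complex.exp (-(t / 2)) := by
  by_cases h : t = 0
  · simp [h]
  · rw [sFun, if_neg h, Complex.sinh]
    field_simp

/-- `z s(wk) = (b^k - b^{-k}) / (ħ^{1/2} k)` with `w = ħ^{1/2} z`, `b = e^{w/2}`. -/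
theorem amplitude_mul (z ħ : ℂ) (k : ℕ+) :
    amplitude z ħ k * (sqrtH ħ * (k : ℕ)) = expDiff (Complex.exp (sqrtH ħ * z / 2)) k := by
  have h := sFun_mul_self (sqrtH ħ * z * (k : ℕ))
  rw [expDiff, ← Complex.exp_neg, ← Complex.exp_nat_mul, ← Complex.exp_nat_mul, amplitude]
  rw [show ((k : ℕ) : ℂ) * (sqrtH ħ * z / 2) = sqrtH ħ * z * (k : ℕ) / 2 by ring,
    show ((k : ℕ) : ℂ) * -(sqrtH ħ * z / 2) = -(sqrtH ħ * z * (k : ℕ) / 2) by ring, ← h]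
  ring

theorem genH_scaleVars {ħ : ℂ} (hħ : ħ ≠ 0) (z u₀ : ℂ) (f : Fock) :
    genH z u₀ ħ (scaleVars (sqrtH ħ)⁻¹ f) = (Complex.exp (z * u₀) / sFun (sqrtH ħ * z)) •
      scaleVars (sqrtH ħ)⁻¹ (vertexOp (Complex.exp (sqrtH ħ * z / 2)) f) := by
  have hs := sqrtH_ne_zero hħ
  rw [genH_eq_shiftPairing, LinearMap.smul_apply, vertexOp]
  congr 1
  refine shiftPairing_scaleVars (fun n => ?_) (fun k => ?_) f
  · rw [vertexCoeff, expCoeff, expCoeff, map_sum]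
    refine Finset.sum_congr rfl fun μ _ => ?_
    rw [dividedMonomial, dividedMonomial, Finsupp.prod, Finsupp.prod, map_prod]
    refine Finset.prod_congr rfl fun k _ => ?_
    have hk : ((k : ℕ) : ℂ) ≠ 0 := by exact_mod_cast k.ne_zero
    have h1 : expDiff (Complex.exp (sqrtH ħ * z / 2)) k / (k : ℕ) * (sqrtH ħ)⁻¹ =
        amplitude z ħ k := by
      rw [← amplitude_mul]; field_simp
    rw [map_mul, map_pow, map_mul, scaleVars_C, scaleVars_C, scaleVars_X, ← mul_assoc,
      ← map_mul, h1]
  · rw [← amplitude_mul]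
    have := sqrtH_mul_self ħ
    field_simp
    linear_combination -amplitude z ħ k * this

/-- The eigenvalue of the generating operator, in a form that is defined (and analytic) around
`z = 0`, with `b = e^{ħ^{1/2} z / 2}`. -/
def eigenFun (lam : YoungDiagram) (u₀ ħ z : ℂ) : ℂ :=
  Complex.exp (z * u₀) / sFun (sqrtH ħ * z) *
    ((Complex.exp (sqrtH ħ * z / 2))⁻¹ ^ (2 * lam.colLen 0) +
      (1 - (Complex.exp (sqrtH ħ * z / 2))⁻¹ ^ 2) * ∑ i ∈ Finset.range (lam.colLen 0),
        Complex.exp (sqrtH ħ * z / 2) ^ (2 * lam.rowLen i) *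
          (Complex.exp (sqrtH ħ * z / 2))⁻¹ ^ (2 * i))

theorem genH_schurRescaled {ħ : ℂ} (hħ : ħ ≠ 0) (z u₀ : ℂ) (lam : YoungDiagram) :
    genH z u₀ ħ (schurRescaled ħ lam) = eigenFun lam u₀ ħ z • schurRescaled ħ lam := by
  have h := vertexOp_jacobiTrudi (Complex.exp_ne_zero (sqrtH ħ * z / 2))
    fun i : Fin (lam.colLen 0) => lam.rowLen i
  rw [← schur_eq_jacobiTrudi] at h
  rw [schurRescaled_eq, genH_scaleVars hħ, h, map_smul, smul_smul, eigenFun, Finset.sum_range]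

/-- The basis of rescaled Schur polynomials. -/
def schurRescaledBasis {ħ : ℂ} (hħ : ħ ≠ 0) : Module.Basis YoungDiagram ℂ Fock :=
  schurBasis.map (AlgEquiv.ofAlgHom (scaleVars (sqrtH ħ)⁻¹) (scaleVars (sqrtH ħ))
    (scaleVars_comp (inv_mul_cancel₀ (sqrtH_ne_zero hħ)))
    (scaleVars_comp (mul_inv_cancel₀ (sqrtH_ne_zero hħ)))).toLinearEquiv

theorem schurRescaledBasis_apply {ħ : ℂ} (hħ : ħ ≠ 0) (lam : YoungDiagram) :
    schurRescaledBasis hħ lam = schurRescaled ħ lam := by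
  rw [schurRescaledBasis, Module.Basis.map_apply, schurBasis, Module.Basis.mk_apply,
    schurRescaled_eq]
  rfl

theorem schurRescaled_ne_zero {ħ : ℂ} (hħ : ħ ≠ 0) (lam : YoungDiagram) :
    schurRescaled ħ lam ≠ 0 := by
  rw [← schurRescaledBasis_apply hħ]
  exact Module.Basis.ne_zero _ _

theorem rowLen_eq_zero {lam : YoungDiagram} {i : ℕ} (hi : lam.colLen 0 ≤ i) : lam.rowLen i = 0 := by
  by_contra h
  have := YoungDiagram.mem_iff_lt_colLen.1
    (YoungDiagram.mem_iff_lt_rowLen.2 (Nat.pos_of_ne_zero h))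
  omega

/-- Beyond the length of the partition the series for the eigenvalue is geometric. -/
theorem hasSum_eigenTerm {z ħ : ℂ} (h : 0 < (sqrtH ħ * z).re) (lam : YoungDiagram) :
    HasSum (eigenTerm z lam ħ)
      (((Complex.exp (sqrtH ħ * z / 2))⁻¹ ^ (2 * lam.colLen 0) /
          (1 - (Complex.exp (sqrtH ħ * z / 2))⁻¹ ^ 2) +
        ∑ i ∈ Finset.range (lam.colLen 0), Complex.exp (sqrtH ħ * z / 2) ^ (2 * lam.rowLen i) *
          (Complex.exp (sqrtH ħ * z / 2))⁻¹ ^ (2 * i)) * (Complex.exp (sqrtH ħ * z / 2))⁻¹) := by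
  set b := Complex.exp (sqrtH ħ * z / 2) with hb
  have hterm : ∀ j, eigenTerm z lam ħ j = b ^ (2 * lam.rowLen j) * b⁻¹ ^ (2 * j) * b⁻¹ := by
    intro j
    rw [hb, ← Complex.exp_neg, ← Complex.exp_nat_mul, ← Complex.exp_nat_mul, ← Complex.exp_add,
      ← Complex.exp_add, eigenTerm]
    congr 1
    push_cast
    ring
  have hnorm : ‖b⁻¹ ^ 2‖ < 1 := by
    rw [hb, ← Complex.exp_neg, ← Complex.exp_nat_mul, Complex.norm_exp, Real.exp_lt_one_iff]
    have : (((2 : ℕ) : ℂ) * -(sqrtH ħ * z / 2)) = -(sqrtH ħ * z) := by push_cast; ring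
    rw [this, Complex.neg_re]
    linarith
  have hfun : eigenTerm z lam ħ = fun j => b ^ (2 * lam.rowLen j) * b⁻¹ ^ (2 * j) * b⁻¹ :=
    funext hterm
  rw [hfun]
  refine HasSum.mul_right _ ?_
  rw [← hasSum_nat_add_iff (lam.colLen 0)]
  have hg := (hasSum_geometric_of_norm_lt_one hnorm).mul_left (b⁻¹ ^ (2 * lam.colLen 0))
  rw [← div_eq_mul_inv] at hg
  refine hg.congr_fun fun j => ?_
  rw [rowLen_eq_zero (by omega)]
  ring

theorem eigenE_eq_eigenFun {z ħ : ℂ} (h : 0 < (sqrtH ħ * z).re) (u₀ : ℂ) (lam : YoungDiagram) :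
    eigenE z lam u₀ ħ = eigenFun lam u₀ ħ z := by
  have hw : sqrtH ħ * z ≠ 0 := by
    intro h0
    rw [h0] at h
    simp at h
  rw [eigenE, (hasSum_eigenTerm h lam).tsum_eq, eigenFun]
  have hs := sFun_mul_self (sqrtH ħ * z)
  rw [Complex.exp_neg] at hs
  have hb := Complex.exp_ne_zero (sqrtH ħ * z / 2)
  have hnorm : 1 - (Complex.exp (sqrtH ħ * z / 2))⁻¹ ^ 2 ≠ 0 := by
    rw [← Complex.exp_neg, ← Complex.exp_nat_mul, sub_ne_zero]
    intro h1
    have h2 := congrArg norm h1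
    rw [Complex.norm_exp, norm_one, eq_comm, Real.exp_eq_one_iff] at h2
    have : (((2 : ℕ) : ℂ) * -(sqrtH ħ * z / 2)) = -(sqrtH ħ * z) := by push_cast; ring
    rw [this, Complex.neg_re] at h2
    linarith
  set b := Complex.exp (sqrtH ħ * z / 2)
  set S := ∑ i ∈ Finset.range (lam.colLen 0), b ^ (2 * lam.rowLen i) * b⁻¹ ^ (2 * i)
  set P := b⁻¹ ^ (2 * lam.colLen 0)
  have hsb : sFun (sqrtH ħ * z) * (sqrtH ħ * z) = b * (1 - b⁻¹ ^ 2) := by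
    rw [hs]; field_simp
  have hs0 : sFun (sqrtH ħ * z) ≠ 0 := left_ne_zero_of_mul (hsb ▸ mul_ne_zero hb hnorm)
  have e1 : (P / (1 - b⁻¹ ^ 2) + S) * (1 - b⁻¹ ^ 2) = P + (1 - b⁻¹ ^ 2) * S := by
    rw [add_mul, div_mul_cancel₀ _ hnorm, mul_comm S]
  rw [← e1, div_mul_eq_mul_div, eq_div_iff hs0]
  linear_combination (Complex.exp (z * u₀) * (P / (1 - b⁻¹ ^ 2) + S) * b⁻¹) * hsb +
    (Complex.exp (z * u₀) * (P / (1 - b⁻¹ ^ 2) + S) * (1 - b⁻¹ ^ 2)) * inv_mul_cancel₀ hb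

/-! ### Taylor coefficients -/

theorem sFun_eq_dslope (t : ℂ) : sFun t = dslope Complex.sinh 0 (t / 2) := by
  by_cases h : t = 0
  · simp [sFun, h, dslope_same, Complex.deriv_sinh]
  · have h2 : t / 2 ≠ 0 := div_ne_zero h two_ne_zero
    rw [sFun, if_neg h, dslope_of_ne _ h2, slope_def_field]
    simp

theorem differentiable_sFun : Differentiable ℂ sFun := by
  have h : Differentiable ℂ (dslope Complex.sinh 0) := by
    rw [← differentiableOn_univ, Complex.differentiableOn_dslope Filter.univ_mem]
    exact Complex.differentiable_sinh.differentiableOn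
  have : sFun = fun t => dslope Complex.sinh 0 (t / 2) := funext sFun_eq_dslope
  rw [this]
  exact h.comp (differentiable_id.div_const 2)

theorem sFun_zero : sFun 0 = 1 := by simp [sFun]

theorem sFun_ne_zero {t : ℂ} (ht : ‖t‖ < 2 * Real.pi) : sFun t ≠ 0 := by
  by_cases h : t = 0
  · rw [h, sFun_zero]; exact one_ne_zero
  · intro h0
    have h1 := sFun_mul_self t
    rw [h0, zero_mul, eq_comm, sub_eq_zero] at h1
    have h2 : Complex.exp t = 1 := by
      have : t = t / 2 + t / 2 := by ring
      rw [this, Complex.exp_add]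
      nth_rewrite 1 [h1]
      rw [← Complex.exp_add, neg_add_cancel, Complex.exp_zero]
    obtain ⟨n, hn⟩ := Complex.exp_eq_one_iff.1 h2
    have hn0 : n ≠ 0 := by
      rintro rfl
      exact h (by simpa using hn)
    have h3 : ‖t‖ = |(n : ℝ)| * (2 * Real.pi) := by
      rw [hn, norm_mul, norm_mul, norm_mul, Complex.norm_I, Complex.norm_real, Complex.norm_intCast,
        Real.norm_of_nonneg Real.pi_pos.le]
      simp
    have h4 : (1 : ℝ) ≤ |(n : ℝ)| := by exact_mod_cast Int.one_le_abs hn0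
    have := Real.pi_pos
    nlinarith

theorem contDiffAt_coeff_symbol (u₀ ħ : ℂ) (d : Var →₀ ℕ) (n : ℕ) :
    ContDiffAt ℂ n (fun z => MvPowerSeries.coeff d (symbol z u₀ ħ)) 0 := by
  simp only [coeff_symbol]
  split_ifs
  · have hs : ContDiff ℂ n sFun := differentiable_sFun.contDiff
    refine ContDiffAt.mul (ContDiffAt.div ?_ ?_ ?_) ?_
    · fun_prop
    · exact (hs.comp (contDiff_const.mul contDiff_id)).contDiffAt
    · rw [mul_zero, sFun_zero]; exact one_ne_zero
    · simp only [expMonomial, Finsupp.prod]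
      refine ContDiff.contDiffAt (contDiff_prod fun v _ => ContDiff.div_const (ContDiff.pow ?_ _) _)
      exact contDiff_id.mul (hs.comp ((contDiff_const.mul contDiff_id).mul contDiff_const))
  · exact contDiffAt_const

theorem coeff_symbolCoeff_of_totalFreq_ne_zero (n : ℕ) (u₀ ħ : ℂ) {d : Var →₀ ℕ}
    (hd : totalFreq d ≠ 0) : MvPowerSeries.coeff d (symbolCoeff n u₀ ħ) = 0 := by
  change iteratedDeriv n (fun z : ℂ => MvPowerSeries.coeff d (symbol z u₀ ħ)) 0 /
    (n.factorial : ℂ) = 0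
  simp [coeff_symbol, hd]

/-- Normal ordering commutes with the Taylor expansion, matrix coefficient by matrix
coefficient. -/
theorem coeff_normalOrder_symbolCoeff (n : ℕ) (u₀ ħ : ℂ) (e : ℕ+ →₀ ℕ) (f : Fock) :
    ContDiffAt ℂ n (fun z => MvPolynomial.coeff e (genH z u₀ ħ f)) 0 ∧
    MvPolynomial.coeff e (normalOrder ħ (symbolCoeff n u₀ ħ) f) =
      iteratedDeriv n (fun z => MvPolynomial.coeff e (genH z u₀ ħ f)) 0 / (n.factorial : ℂ) := by
  induction f using MvPolynomial.induction_on' with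
  | monomial m a =>
    have ha : (MvPolynomial.monomial m a : Fock) = a • MvPolynomial.monomial m 1 := by
      rw [MvPolynomial.smul_monomial, smul_eq_mul, mul_one]
    have h1 : ∀ z, MvPolynomial.coeff e (genH z u₀ ħ (MvPolynomial.monomial m a)) =
        ∑ ν ∈ Finset.Iic m, ∑ μ ∈ exponents (wt ν),
          MvPowerSeries.coeff (μ.sumElim ν) (symbol z u₀ ħ) * (a * MvPolynomial.coeff e
            (normalMonomial ħ (μ.sumElim ν) (MvPolynomial.monomial m 1))) := by
      intro z
      rw [ha, map_smul, MvPolynomial.coeff_smul, genH,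
        normalOrder_monomial ħ (fun d hd => by rw [coeff_symbol, if_neg hd])]
      simp only [MvPolynomial.coeff_sum, MvPolynomial.coeff_smul, smul_eq_mul, Finset.mul_sum]
      exact Finset.sum_congr rfl fun ν _ => Finset.sum_congr rfl fun μ _ => by ring
    have h2 : MvPolynomial.coeff e
        (normalOrder ħ (symbolCoeff n u₀ ħ) (MvPolynomial.monomial m a)) =
        ∑ ν ∈ Finset.Iic m, ∑ μ ∈ exponents (wt ν),
          MvPowerSeries.coeff (μ.sumElim ν) (symbolCoeff n u₀ ħ) * (a * MvPolynomial.coeff e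
            (normalMonomial ħ (μ.sumElim ν) (MvPolynomial.monomial m 1))) := by
      rw [ha, map_smul, MvPolynomial.coeff_smul,
        normalOrder_monomial ħ (fun d hd => coeff_symbolCoeff_of_totalFreq_ne_zero n u₀ ħ hd)]
      simp only [MvPolynomial.coeff_sum, MvPolynomial.coeff_smul, smul_eq_mul, Finset.mul_sum]
      exact Finset.sum_congr rfl fun ν _ => Finset.sum_congr rfl fun μ _ => by ring
    have hc : ∀ μ ν : ℕ+ →₀ ℕ, ContDiffAt ℂ n (fun z =>
        MvPowerSeries.coeff (μ.sumElim ν) (symbol z u₀ ħ) * (a * MvPolynomial.coeff e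
            (normalMonomial ħ (μ.sumElim ν) (MvPolynomial.monomial m 1)))) 0 := fun μ ν =>
      (contDiffAt_coeff_symbol u₀ ħ _ n).mul contDiffAt_const
    have hc' : ∀ ν : ℕ+ →₀ ℕ, ContDiffAt ℂ n (fun z => ∑ μ ∈ exponents (wt ν),
        MvPowerSeries.coeff (μ.sumElim ν) (symbol z u₀ ħ) * (a * MvPolynomial.coeff e
            (normalMonomial ħ (μ.sumElim ν) (MvPolynomial.monomial m 1)))) 0 := fun ν =>
      ContDiffAt.sum fun μ _ => hc μ ν
    simp only [h1, h2]
    refine ⟨ContDiffAt.sum fun ν _ => hc' ν, ?_⟩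
    rw [iteratedDeriv_fun_sum (fun ν _ => hc' ν), Finset.sum_div]
    refine Finset.sum_congr rfl fun ν _ => ?_
    rw [iteratedDeriv_fun_sum (fun μ _ => hc μ ν), Finset.sum_div]
    refine Finset.sum_congr rfl fun μ _ => ?_
    change iteratedDeriv n (fun z : ℂ => MvPowerSeries.coeff (μ.sumElim ν) (symbol z u₀ ħ)) 0 /
      (n.factorial : ℂ) * _ = _
    rw [iteratedDeriv_mul_const_field]
    ring
  | add f g hf hg =>
    simp only [map_add, MvPolynomial.coeff_add]
    refine ⟨hf.1.add hg.1, ?_⟩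
    rw [hf.2, hg.2, iteratedDeriv_fun_add hf.1 hg.1, add_div]

theorem normalOrder_symbolCoeff_schurRescaled {ħ : ℂ} (hħ : ħ ≠ 0) (n : ℕ) (u₀ : ℂ)
    (lam : YoungDiagram) : normalOrder ħ (symbolCoeff n u₀ ħ) (schurRescaled ħ lam) =
      (iteratedDeriv n (eigenFun lam u₀ ħ) 0 / (n.factorial : ℂ)) • schurRescaled ħ lam := by
  ext e
  rw [(coeff_normalOrder_symbolCoeff n u₀ ħ e _).2, MvPolynomial.coeff_smul, smul_eq_mul]
  simp only [genH_schurRescaled hħ, MvPolynomial.coeff_smul, smul_eq_mul]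
  rw [iteratedDeriv_mul_const_field]
  ring

theorem differentiableAt_eigenFun {z ħ : ℂ} (h : ‖sqrtH ħ * z‖ < 2 * Real.pi) (u₀ : ℂ)
    (lam : YoungDiagram) : DifferentiableAt ℂ (eigenFun lam u₀ ħ) z := by
  have hs : DifferentiableAt ℂ (fun z => sFun (sqrtH ħ * z)) z :=
    (differentiable_sFun.comp (differentiable_id.const_mul _)).differentiableAt
  have hb : ∀ z, Complex.exp (sqrtH ħ * z / 2) ≠ 0 := fun z => Complex.exp_ne_zero _
  unfold eigenFun
  simp only [← Complex.exp_neg]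
  refine DifferentiableAt.mul (DifferentiableAt.div ?_ hs (sFun_ne_zero h)) ?_
  · fun_prop
  · fun_prop

theorem eigenFun_zero (lam : YoungDiagram) (u₀ ħ : ℂ) : eigenFun lam u₀ ħ 0 = 1 := by
  simp [eigenFun, sFun_zero]

theorem hasSum_eigenFun {z ħ : ℂ} (hħ : ħ ≠ 0) (h : ‖sqrtH ħ * z‖ < 2 * Real.pi) (u₀ : ℂ)
    (lam : YoungDiagram) :
    HasSum (fun k : ℕ => iteratedDeriv (k + 1) (eigenFun lam u₀ ħ) 0 /
      ((k + 1).factorial : ℂ) * z ^ (k + 1)) (eigenFun lam u₀ ħ z - 1) := by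
  have hs : 0 < ‖sqrtH ħ‖ := norm_pos_iff.2 (sqrtH_ne_zero hħ)
  have hmem : ∀ x : ℂ, x ∈ Metric.ball (0 : ℂ) (2 * Real.pi / ‖sqrtH ħ‖) ↔
      ‖sqrtH ħ * x‖ < 2 * Real.pi := by
    intro x
    rw [mem_ball_zero_iff, lt_div_iff₀ hs, norm_mul, mul_comm]
  have hd : DifferentiableOn ℂ (eigenFun lam u₀ ħ)
      (Metric.ball (0 : ℂ) (2 * Real.pi / ‖sqrtH ħ‖)) := fun x hx =>
    (differentiableAt_eigenFun ((hmem x).1 hx) u₀ lam).differentiableWithinAt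
  have ht := Complex.hasSum_taylorSeries_on_ball hd ((hmem z).2 h)
  rw [← hasSum_nat_add_iff' 1] at ht
  simp only [Finset.sum_range_one, Nat.factorial_zero, Nat.cast_one, inv_one, pow_zero,
    iteratedDeriv_zero, eigenFun_zero, sub_zero, smul_eq_mul, mul_one] at ht
  refine ht.congr_fun fun k => ?_
  ring

end HopfSchur

end

theorem theorem1 (u₀ ħ : ℂ) (hħ : ħ ≠ 0) :
    -- eigenvectors of the generating operator
    (∀ (lam : YoungDiagram) (z : ℂ), 0 < (HopfSchur.sqrtH ħ * z).re →
      Summable (HopfSchur.eigenTerm z lam ħ) ∧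
      Module.End.HasEigenvector (HopfSchur.genH z u₀ ħ) (HopfSchur.eigenE z lam u₀ ħ)
        (HopfSchur.schurRescaled ħ lam)) ∧
    -- common eigenvectors of all its coefficients, the eigenvalues being those of `E`
    (∀ lam : YoungDiagram, ∃ e : ℕ → ℂ,
      (∀ k : ℕ, Module.End.HasEigenvector (HopfSchur.quantumH k u₀ ħ) (e k)
        (HopfSchur.schurRescaled ħ lam)) ∧
      (∀ z : ℂ, 0 < (HopfSchur.sqrtH ħ * z).re → ‖HopfSchur.sqrtH ħ * z‖ < 2 * Real.pi →
        HasSum (fun k : ℕ => e k * z ^ (k + 1)) (HopfSchur.eigenE z lam u₀ ħ - 1))) ∧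
    -- the Schur polynomials of degree `n` form a basis of the degree `n` part, `deg q_k = k`
    (∀ n : ℕ,
      LinearIndependent ℂ
        (fun lam : {lam : YoungDiagram // lam.card = n} => HopfSchur.schur lam.1) ∧
      Submodule.span ℂ
        (Set.range fun lam : {lam : YoungDiagram // lam.card = n} => HopfSchur.schur lam.1) =
        MvPolynomial.weightedHomogeneousSubmodule ℂ (fun k : ℕ+ => (k : ℕ)) n) ∧
    -- the rescaled Schur polynomials form a basis of the Fock space
    (∃ b : Module.Basis YoungDiagram ℂ HopfSchur.Fock,
      ∀ lam : YoungDiagram, b lam = HopfSchur.schurRescaled ħ lam) := by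
  -- The eigenvalues of the Hamiltonians are the Taylor coefficients of `eigenFun`, the analytic
  -- continuation of `E` to a neighbourhood of `z = 0`.
  refine ⟨fun lam z hz => ⟨(HopfSchur.hasSum_eigenTerm hz lam).summable, ?_, ?_⟩,
    fun lam => ⟨fun k => iteratedDeriv (k + 1) (HopfSchur.eigenFun lam u₀ ħ) 0 /
      ((k + 1).factorial : ℂ), fun k => ⟨?_, ?_⟩, fun z hz hz' => ?_⟩,
    fun n => ⟨HopfSchur.linearIndependent_schur_card_eq n, HopfSchur.span_schur_card_eq n⟩,
    HopfSchur.schurRescaledBasis hħ, HopfSchur.schurRescaledBasis_apply hħ⟩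
  · rw [Module.End.mem_eigenspace_iff, HopfSchur.eigenE_eq_eigenFun hz,
      HopfSchur.genH_schurRescaled hħ]
  · exact HopfSchur.schurRescaled_ne_zero hħ lam
  · rw [Module.End.mem_eigenspace_iff]
    exact HopfSchur.normalOrder_symbolCoeff_schurRescaled hħ (k + 1) u₀ lam
  · exact HopfSchur.schurRescaled_ne_zero hħ lam
  · rw [HopfSchur.eigenE_eq_eigenFun hz]
    exact HopfSchur.hasSum_eigenFun hħ hz' u₀ lam
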